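/- Let $(W,S)$ be a Coxeter system with $S$ finite and Coxeter matrix $(m_{st})$, and let $A$ be the associated Artin group: it has generators $a_s$ $(s\in S)$ and, for each pair $s\neq t$ with $m_{st}\neq\infty$, the relation $a_sa_ta_s\cdots=a_ta_sa_t\cdots$ with $m_{st}$ factors on each side. A subset $T\subseteq S$ is spherical if the subgroup $W_T=\langle T\rangle$ is finite. Let $D$ be the graph with vertex set $S$ in which $s$ and $t$ are adjacent if $m_{st}>2$, and for $T\subseteq S$ let $D(T)$ be its full subgraph on $T$; the decomposition of $T$ is the set of vertex sets of the connected components of $D(T)$. Let $S_\oslash$ be the set of nonempty spherical $T\subseteq S$ with $D(T)$ connected, ordered by inclusion. Nested subsets of $S_\oslash$ are defined inductively: $\emptyset$ is nested, and $\alpha\subseteq S_\oslash$ is nested if $\mathrm{sp}(\alpha)=\bigcup_{T\in\alpha}T$ is spherical, the maximal elements of $\alpha$ form the decomposition of $\mathrm{sp}(\alpha)$, and $\{T'\in\alpha: T'\subsetneq T\}$ is nested for every maximal element $T$ of $\alpha$. The complex of standard abelian subgroups $L_\oslash$ is the simplicial complex with vertex set $S_\oslash$ whose simplices are the nonempty nested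 subsets. For a finite simplicial complex $K$ with vertex set $V$, the octahedralization $OK$ is the simplicial complex with vertex set $V\times\{\pm1\}$ whose simplices are the nonempty sets of vertices whose first coordinates are distinct and form a simplex of $K$. Regard $\mathrm{cone}(K)=K\times[0,\infty)/K\times\{0\}$ (a point if $K=\emptyset$) as the union of the orthants $\mathrm{cone}(\sigma)=[0,\infty)^{\sigma}$ over the simplices $\sigma$ of $K$, glued along common faces. Triangulate it with vertex set $\mathrm{cone}(K)^0$, the set of integral points of these orthants, the simplices being the nonempty finite chains of such points (for the coordinatewise order) any two of which differ by at most $1$ in each coordinate. Give $\mathrm{cone}(K)^0$ the edge-length metric of this triangulation, each edge having length $1$ (it is bi-Lipschitz equivalent to the euclidean cone metric), and put $\mathrm{cone}(\sigma)^0=\mathrm{cone}(K)^0\cap\mathrm{cone}(\sigma)$. Two maps $h_1:X_1\to Y$ and $h_2:X_2\to Y$ to a metric space diverge if for every $D>0$ there are compact sets $C_i\subseteq X_i$ such that $d(h_1(x_1),h_2(x_2))>D$ for all $x_i\in X_i\setminus C_i$ $(i=1,2)$. A map $h:\mathrm{cone}(K)^0\to Y$ is expanding if $h|_{\mathrm{cone}(\sigma)^0}$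 and $h|_{\mathrm{cone}(\tau)^0}$ diverge for any two disjoint simplices $\sigma,\tau$ of $K$. Theorem. For every word metric on $A$ (with respect to any finite generating set), there is a proper, expanding, Lipschitz map $\mathrm{cone}(OL_\oslash)^0\to A$. In symbols, ``$OL_\oslash\subset\partial A$''. -/

import Mathlib

/-! ### Coxeter diagrams, spherical subsets, Artin groups -/

namespace CoxeterMatrix

/-- The (unlabelled) Coxeter diagram: `s` and `t` are joined when `m_{st} > 2`. The entry `∞` is
encoded by `0`, so this says that `s ≠ t` and `m_{st} ≠ 2`. -/
def diagram {B : Type*} (M : CoxeterMatrix B) : SimpleGraph B where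
  Adj s t := s ≠ t ∧ M s t ≠ 2
  symm := ⟨fun s t h => ⟨h.1.symm, by rw [M.symmetric t s]; exact h.2⟩⟩
  loopless := ⟨fun _ h => h.1 rfl⟩

/-- The decomposition of a set `U` of generators: the family of the vertex sets of the connected
components of the full subgraph of the diagram spanned by `U`. -/
def components {B : Type*} (M : CoxeterMatrix B) (U : Set B) : Set (Set B) :=
  {T | ∃ c : (M.diagram.induce U).ConnectedComponent, T = Subtype.val '' c.supp}

/-- The alternating product `a * b * a * ⋯` with `n` factors. -/
def altProd {G : Type*} [Monoid G] (a b : G) : ℕ → G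
  | 0 => 1
  | n + 1 => a * altProd b a n

/-- The Artin relators: `a_s a_t a_s ⋯ = a_t a_s a_t ⋯` with `m_{st}` factors on both sides. There is
no relation when `m_{st} = ∞`, which is encoded by `0`: the relator is then `1`. -/
def artinRelators {B : Type*} (M : CoxeterMatrix B) : Set (FreeGroup B) :=
  {r | ∃ s t : B, r = altProd (FreeGroup.of s) (FreeGroup.of t) (M s t) *
    (altProd (FreeGroup.of t) (FreeGroup.of s) (M s t))⁻¹}

/-- The Artin group associated to a Coxeter matrix. -/
abbrev ArtinGroup {B : Type*} (M : CoxeterMatrix B) : Type _ :=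
  PresentedGroup M.artinRelators

/-- Two sets of generators are orthogonal if they are at distance at least `2` in the diagram. -/
def Orthogonal {B : Type*} (M : CoxeterMatrix B) (T T' : Set B) : Prop :=
  ∀ s ∈ T, ∀ t ∈ T', s ≠ t ∧ ¬ M.diagram.Adj s t

theorem Orthogonal.symm {B : Type*} {M : CoxeterMatrix B} {T T' : Set B}
    (h : M.Orthogonal T T') : M.Orthogonal T' T :=
  fun s hs t ht => ⟨(h t ht s hs).1.symm, fun hh => (h t ht s hs).2 hh.symm⟩

theorem orthogonal_of_mem_components {B : Type*} {M : CoxeterMatrix B} {U T T' : Set B}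
    (hT : T ∈ M.components U) (hT' : T' ∈ M.components U) (hne : T ≠ T') :
    M.Orthogonal T T' := by
  obtain ⟨c, rfl⟩ := hT
  obtain ⟨c', rfl⟩ := hT'
  rintro _ ⟨s, hs, rfl⟩ _ ⟨t, ht, rfl⟩
  rw [SimpleGraph.ConnectedComponent.mem_supp_iff] at hs ht
  have hcc : c ≠ c' := fun h => hne (by rw [h])
  refine ⟨fun h => hcc ?_, fun h => hcc ?_⟩
  · rw [← hs, ← ht, Subtype.ext h]
  · rw [← hs, ← ht]
    have h' : (M.diagram.induce U).Adj s t := h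
    exact SimpleGraph.ConnectedComponent.sound h'.reachable

theorem components_eq_of_orthogonal {B : Type*} {M : CoxeterMatrix B} {F : Set (Set B)}
    (hconn : ∀ T ∈ F, (M.diagram.induce T).Connected)
    (horth : ∀ T ∈ F, ∀ T' ∈ F, T ≠ T' → M.Orthogonal T T') :
    M.components (⋃₀ F) = F := by
  have key : ∀ T ∈ F, ∀ s : (⋃₀ F : Set B), s.1 ∈ T →
      Subtype.val '' ((M.diagram.induce (⋃₀ F)).connectedComponentMk s).supp = T := by
    intro T hT s hs
    apply Set.Subset.antisymm
    · rintro _ ⟨t, ht, rfl⟩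
      rw [SimpleGraph.ConnectedComponent.mem_supp_iff, SimpleGraph.ConnectedComponent.eq] at ht
      obtain ⟨w⟩ := ht.symm
      clear ht
      induction w with
      | nil => exact hs
      | cons h p ih =>
        apply ih
        rename_i u v w
        obtain ⟨T', hT', hv⟩ := v.2
        by_cases hTT : T = T'
        · rw [hTT]; exact hv
        · exact absurd h (horth T hT T' hT' hTT _ hs _ hv).2
    · intro t ht
      refine ⟨⟨t, T, hT, ht⟩, ?_, rfl⟩
      rw [SimpleGraph.ConnectedComponent.mem_supp_iff, SimpleGraph.ConnectedComponent.eq]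
      exact ((hconn T hT).preconnected ⟨t, ht⟩ ⟨s.1, hs⟩).map
        (SimpleGraph.induceHomOfLE M.diagram (Set.subset_sUnion_of_mem hT)).toHom
  ext T
  constructor
  · rintro ⟨c, rfl⟩
    induction c using SimpleGraph.ConnectedComponent.ind with
    | h s =>
      obtain ⟨T, hT, hs⟩ := s.2
      rw [key T hT s hs]
      exact hT
  · intro hT
    obtain ⟨s⟩ := (hconn T hT).nonempty
    exact ⟨_, (key T hT ⟨s.1, T, hT, s.2⟩ s.2).symm⟩

end CoxeterMatrix

/-! ### The complex of standard abelian subgroups -/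

namespace CoxeterSystem

/-- A set `T` of generators is spherical if the special subgroup `W_T` is finite. -/
def IsSpherical {B W : Type*} [Group W] {M : CoxeterMatrix B} (cs : CoxeterSystem M W)
    (T : Set B) : Prop :=
  Finite (Subgroup.closure (cs.simple '' T))

/-- The nonempty irreducible spherical sets of generators, ordered by inclusion. (Mathlib's
`SimpleGraph.Connected` includes nonemptiness.) -/
abbrev IrredSpherical {B W : Type*} [Group W] {M : CoxeterMatrix B} (cs : CoxeterSystem M W) :
    Type _ :=
  {T : Set B // cs.IsSpherical T ∧ (M.diagram.induce T).Connected}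

/-- The support of a finite set of irreducible spherical subsets: their union. -/
def support {B W : Type*} [Group W] {M : CoxeterMatrix B} {cs : CoxeterSystem M W}
    (α : Finset cs.IrredSpherical) : Set B :=
  ⋃ T ∈ α, T.1

open Classical in
/-- Nested sets of irreducible spherical subsets: `∅` is nested; and `α` is nested if its support is
spherical, its maximal elements form the decomposition of its support into irreducibles, and, for
every maximal element `T`, the set of the elements of `α` strictly below `T` is nested. -/
inductive IsNested {B W : Type*} [Group W] {M : CoxeterMatrix B} (cs : CoxeterSystem M W) :
    Finset cs.IrredSpherical → Prop
  | empty : IsNested cs ∅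
  | step (α : Finset cs.IrredSpherical) (spherical : cs.IsSpherical (support α))
      (decomposition : Subtype.val '' {T | Maximal (· ∈ α) T} = M.components (support α))
      (below : ∀ T, Maximal (· ∈ α) T → IsNested cs {T' ∈ α | T' < T}) : IsNested cs α

theorem IsSpherical.mono {B W : Type*} [Group W] {M : CoxeterMatrix B} {cs : CoxeterSystem M W}
    {T T' : Set B} (h : cs.IsSpherical T') (hT : T ⊆ T') : cs.IsSpherical T :=
  Set.Finite.subset (s := (Subgroup.closure (cs.simple '' T') : Set W)) h
    (Subgroup.closure_mono (Set.image_mono hT))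

theorem support_mono {B W : Type*} [Group W] {M : CoxeterMatrix B} {cs : CoxeterSystem M W}
    {α β : Finset cs.IrredSpherical} (h : β ⊆ α) : support β ⊆ support α :=
  Set.biUnion_mono (fun _ hx => h hx) (fun _ _ => subset_rfl)

theorem support_eq_sUnion_maximal {B W : Type*} [Group W] {M : CoxeterMatrix B}
    {cs : CoxeterSystem M W} (α : Finset cs.IrredSpherical) :
    support α = ⋃₀ (Subtype.val '' {T | Maximal (· ∈ α) T}) := by
  ext s
  simp only [support, Set.mem_iUnion, Set.mem_sUnion, Set.mem_image, Set.mem_ofPred_eq]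
  constructor
  · rintro ⟨T, hT, hs⟩
    obtain ⟨T', hle, hT'⟩ := α.exists_le_maximal hT
    exact ⟨T'.1, ⟨T', hT', rfl⟩, hle hs⟩
  · rintro ⟨_, ⟨T, hT, rfl⟩, hs⟩
    exact ⟨T, hT.prop, hs⟩

/-- A finite set of irreducible spherical subsets is nested if and only if its support is spherical
and its elements are pairwise comparable or orthogonal. -/
theorem isNested_iff {B W : Type*} [Group W] {M : CoxeterMatrix B} {cs : CoxeterSystem M W}
    {α : Finset cs.IrredSpherical} :
    cs.IsNested α ↔ cs.IsSpherical (support α) ∧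
      ∀ T ∈ α, ∀ T' ∈ α, T ≤ T' ∨ T' ≤ T ∨ M.Orthogonal T.1 T'.1 := by
  classical
  constructor
  · intro h
    induction h with
    | empty =>
      refine ⟨?_, by simp⟩
      simp only [IsSpherical, support, Finset.notMem_empty, Set.iUnion_of_empty, Set.iUnion_empty,
        Set.image_empty, Subgroup.closure_empty]
      infer_instance
    | step α hsph hdec hbelow ih =>
      refine ⟨hsph, fun T hT T' hT' => ?_⟩
      obtain ⟨U, hTU, hU⟩ := α.exists_le_maximal hT
      obtain ⟨U', hTU', hU'⟩ := α.exists_le_maximal hT'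
      by_cases hUU : U = U'
      · subst hUU
        rcases hTU.eq_or_lt with rfl | h1
        · exact Or.inr (Or.inl hTU')
        rcases hTU'.eq_or_lt with rfl | h2
        · exact Or.inl hTU
        exact (ih U hU).2 T (by simpa using ⟨hT, h1⟩) T' (by simpa using ⟨hT', h2⟩)
      · refine Or.inr (Or.inr fun s hs t ht => ?_)
        have h1 : U.1 ∈ M.components (support α) := hdec ▸ ⟨U, hU, rfl⟩
        have h2 : U'.1 ∈ M.components (support α) := hdec ▸ ⟨U', hU', rfl⟩
        exact CoxeterMatrix.orthogonal_of_mem_components h1 h2 (fun h => hUU (Subtype.ext h))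
          s (hTU hs) t (hTU' ht)
  · induction α using Finset.strongInduction with
    | H α ih =>
      rintro ⟨hsph, hpair⟩
      refine IsNested.step α hsph ?_ fun T hT => ?_
      · rw [support_eq_sUnion_maximal, CoxeterMatrix.components_eq_of_orthogonal]
        · rintro _ ⟨T, -, rfl⟩
          exact T.2.2
        · rintro _ ⟨T, hT, rfl⟩ _ ⟨T', hT', rfl⟩ hne
          rcases hpair T hT.prop T' hT'.prop with h | h | h
          · exact absurd (congrArg Subtype.val (hT.eq_of_le hT'.prop h)) hne
          · exact absurd (congrArg Subtype.val (hT'.eq_of_le hT.prop h)).symm hne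
          · exact h
      · have hss : {T' ∈ α | T' < T} ⊆ α := Finset.filter_subset _ _
        have hssub : {T' ∈ α | T' < T} ⊂ α :=
          ⟨hss, fun h => lt_irrefl T (Finset.mem_filter.1 (h hT.prop)).2⟩
        exact ih _ hssub ⟨hsph.mono (support_mono hss),
          fun U hU U' hU' => hpair U (hss hU) U' (hss hU')⟩

/-- The complex of standard abelian subgroups: its vertices are the nonempty irreducible spherical
subsets of the generators, and its simplices are the nonempty nested sets of vertices. -/
def standardAbelianComplex {B W : Type*} [Group W] {M : CoxeterMatrix B}
    (cs : CoxeterSystem M W) : AbstractSimplicialComplex cs.IrredSpherical where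
  faces := {α | α.Nonempty ∧ cs.IsNested α}
  isRelLowerSet_faces := fun α hα => ⟨hα.1, fun β hβ hne => ⟨hne, isNested_iff.2
    ⟨(isNested_iff.1 hα.2).1.mono (support_mono hβ),
      fun T hT T' hT' => (isNested_iff.1 hα.2).2 T (hβ hT) T' (hβ hT')⟩⟩⟩
  singleton_mem := fun T => ⟨Finset.singleton_nonempty T, isNested_iff.2
    ⟨T.2.1.mono (by simp [support]), fun U hU U' hU' => Or.inl
      (le_of_eq ((Finset.mem_singleton.1 hU).trans (Finset.mem_singleton.1 hU').symm))⟩⟩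

end CoxeterSystem

/-! ### Octahedralization -/

open Classical in
/-- The octahedralization of a simplicial complex `K` on `V`: its vertex set is `V × {±1}`, and a
nonempty finite set of vertices is a simplex when its first coordinates are distinct and form a
simplex of `K`. -/
def AbstractSimplicialComplex.octahedralization {V : Type*} (K : AbstractSimplicialComplex V) :
    AbstractSimplicialComplex (V × ℤˣ) where
  faces := {s | Set.InjOn Prod.fst (s : Set (V × ℤˣ)) ∧ s.image Prod.fst ∈ K.faces}
  isRelLowerSet_faces := fun s hs =>
    ⟨Finset.image_nonempty.1 (K.isRelLowerSet_faces hs.2).1, fun t hts hne =>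
      ⟨hs.1.mono (Finset.coe_subset.2 hts), (K.isRelLowerSet_faces hs.2).2
        (Finset.image_subset_image hts) (Finset.image_nonempty.2 hne)⟩⟩
  singleton_mem := fun v => ⟨by simp, by simpa using K.singleton_mem v.1⟩

/-! ### The metric space of vertices of a connected graph, and word metrics -/

/-- The vertex set of a connected graph with its edge-length metric, each edge of length `1`. The
topology is the metric topology. -/
noncomputable abbrev SimpleGraph.edgeMetric {X : Type*} (G : SimpleGraph X) (hG : G.Connected) :
    MetricSpace X where
  dist x y := (G.dist x y : ℝ)
  dist_self x := by simp
  dist_comm x y := by rw [SimpleGraph.dist_comm]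
  dist_triangle x y z := by exact_mod_cast hG.dist_triangle
  eq_of_dist_eq_zero {x y} h := hG.dist_eq_zero_iff.1 (by exact_mod_cast h)

theorem SimpleGraph.mulCayley_connected {G : Type*} [Group G] {A : Set G}
    (hA : Subgroup.closure A = ⊤) : (SimpleGraph.mulCayley A).Connected := by
  have step : ∀ x : G, ∀ a ∈ A, (SimpleGraph.mulCayley A).Reachable x (x * a) := by
    intro x a ha
    by_cases h : x = x * a
    · rw [← h]
    · exact SimpleGraph.Adj.reachable
        ((SimpleGraph.mulCayley_adj' A x (x * a)).2 ⟨h, a, ha, Or.inl rfl⟩)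
  have one : ∀ x : G, (SimpleGraph.mulCayley A).Reachable 1 x := by
    intro x
    have hx : x ∈ Subgroup.closure A := hA ▸ Subgroup.mem_top x
    induction hx using Subgroup.closure_induction_right with
    | one => exact SimpleGraph.Reachable.refl _
    | mul_right x _ a ha ih => exact ih.trans (step x a ha)
    | mul_inv_cancel x _ a ha ih =>
      refine ih.trans ?_
      have := step (x * a⁻¹) a ha
      rw [inv_mul_cancel_right] at this
      exact this.symm
  exact { preconnected := fun x y => (one x).symm.trans (one y), nonempty := ⟨1⟩ }

/-- The word metric on a group with respect to a finite generating set `A`: the edge-length metric of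
the Cayley graph, in which `x` and `x * a` are joined for `a ∈ A`. Thus `d(x, y)` is the least length
of an expression of `x⁻¹ * y` as a product of elements of `A` and their inverses. -/
noncomputable abbrev wordMetric {G : Type*} [Group G] (A : Finset G)
    (hA : Subgroup.closure (A : Set G) = ⊤) : MetricSpace G :=
  (SimpleGraph.mulCayley (A : Set G)).edgeMetric (SimpleGraph.mulCayley_connected hA)

/-! ### The zero-skeleton of the cone on a simplicial complex -/

namespace AbstractSimplicialComplex

/-- The vertices of the standard triangulation of `cone K = K × [0, ∞) / K × {0}`. With the piecewise
spherical structure on `K` whose edges have length `π / 2`, the cone on a simplex `σ` is the orthant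
`[0, ∞)^σ`, and `cone K` is the union of these orthants, glued along their faces. The vertices are the
integral points of these orthants; the cone point is `0`. -/
def ConeVertex {V : Type*} (K : AbstractSimplicialComplex V) : Type _ :=
  {x : V →₀ ℕ // x.support = ∅ ∨ x.support ∈ K}

/-- The standard triangulation of `cone K`: each orthant is subdivided into its integral unit cubes,
and each cube into the simplices spanned by the chains of its vertices. So a simplex is a nonempty
finite chain of integral points, for the coordinatewise order, any two of which differ by at most
`1` in each coordinate. For every simplex `σ` of `K` the simplices with vertices supported in `σ`
triangulate the subspace `cone σ`. -/
def coneTriangulation {V : Type*} (K : AbstractSimplicialComplex V) :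
    AbstractSimplicialComplex K.ConeVertex where
  faces := {s | s.Nonempty ∧ ∀ x ∈ s, ∀ y ∈ s,
    (∀ v, x.1 v ≤ y.1 v ∧ y.1 v ≤ x.1 v + 1) ∨ (∀ v, y.1 v ≤ x.1 v ∧ x.1 v ≤ y.1 v + 1)}
  isRelLowerSet_faces := fun _ hs =>
    ⟨hs.1, fun _ hts hne => ⟨hne, fun x hx y hy => hs.2 x (hts hx) y (hts hy)⟩⟩
  singleton_mem := fun x => ⟨Finset.singleton_nonempty x, fun y hy z hz => by
    rw [Finset.mem_singleton] at hy hz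
    subst hy hz
    exact Or.inl fun v => ⟨le_rfl, Nat.le_succ _⟩⟩

open Classical in
/-- The `1`-skeleton of a simplicial complex, as a graph. -/
def edgeGraph {V : Type*} (K : AbstractSimplicialComplex V) : SimpleGraph V where
  Adj x y := x ≠ y ∧ {x, y} ∈ K
  symm := ⟨fun x y h => ⟨h.1.symm, by rw [Finset.pair_comm]; exact h.2⟩⟩
  loopless := ⟨fun _ h => h.1 rfl⟩

theorem coneTriangulation_adj {V : Type*} (K : AbstractSimplicialComplex V)
    (x y : K.ConeVertex) : K.coneTriangulation.edgeGraph.Adj x y ↔ x ≠ y ∧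
      ((∀ v, x.1 v ≤ y.1 v ∧ y.1 v ≤ x.1 v + 1) ∨
        (∀ v, y.1 v ≤ x.1 v ∧ x.1 v ≤ y.1 v + 1)) := by
  classical
  refine and_congr_right fun _ => ⟨fun h => h.2 x (by simp) y (by simp), fun h =>
    ⟨⟨x, by simp⟩, fun a ha b hb => ?_⟩⟩
  simp only [Finset.mem_insert, Finset.mem_singleton] at ha hb
  rcases ha with rfl | rfl <;> rcases hb with rfl | rfl
  · exact Or.inl fun v => ⟨le_rfl, Nat.le_succ _⟩
  · exact h
  · exact h.symm
  · exact Or.inl fun v => ⟨le_rfl, Nat.le_succ _⟩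

theorem coneTriangulation_connected {V : Type*} (K : AbstractSimplicialComplex V) :
    K.coneTriangulation.edgeGraph.Connected := by
  let o : K.ConeVertex := ⟨0, Or.inl Finsupp.support_zero⟩
  have key : ∀ n : ℕ, ∀ x : K.ConeVertex, (∀ v, x.1 v ≤ n) →
      K.coneTriangulation.edgeGraph.Reachable o x := by
    intro n
    induction n with
    | zero =>
      intro x hx
      have : o = x := Subtype.ext (Finsupp.ext fun v => (Nat.le_zero.1 (hx v)).symm)
      rw [this]
    | succ n ih =>
      intro x hx
      let y0 : V →₀ ℕ := x.1.mapRange (fun k => k - 1) rfl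
      have hy0 : y0.support = ∅ ∨ y0.support ∈ K := by
        rcases Finset.eq_empty_or_nonempty y0.support with h | h
        · exact Or.inl h
        · have hsub : y0.support ⊆ x.1.support := Finsupp.support_mapRange
          rcases x.2 with hx0 | hxK
          · exact Or.inl (Finset.subset_empty.1 (hx0 ▸ hsub))
          · exact Or.inr ((K.isRelLowerSet_faces hxK).2 hsub h)
      have hy : ∀ v, y0 v = x.1 v - 1 := fun v => Finsupp.mapRange_apply ..
      refine (ih ⟨y0, hy0⟩ fun v => ?_).trans ?_
      · have := hx v
        simp only [hy]
        omega
      · by_cases hxy : (⟨y0, hy0⟩ : K.ConeVertex) = x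
        · rw [hxy]
        · refine SimpleGraph.Adj.reachable ((coneTriangulation_adj K _ _).2 ⟨hxy, Or.inl fun v => ?_⟩)
          simp only [hy]
          omega
  have hall : ∀ x : K.ConeVertex, K.coneTriangulation.edgeGraph.Reachable o x := fun x =>
    key (x.1.support.sup x.1) x fun v => by
      by_cases hv : v ∈ x.1.support
      · exact Finset.le_sup (f := x.1) hv
      · rw [Finsupp.notMem_support_iff.1 hv]
        exact Nat.zero_le _
  exact { preconnected := fun x y => (hall x).symm.trans (hall y), nonempty := ⟨o⟩ }

/-- The edge-length metric on the `0`-skeleton of `cone K`. If `K` is finite, it is bi-Lipschitz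
equivalent to the euclidean cone metric. -/
noncomputable instance {V : Type*} (K : AbstractSimplicialComplex V) :
    MetricSpace K.ConeVertex :=
  K.coneTriangulation.edgeGraph.edgeMetric K.coneTriangulation_connected

end AbstractSimplicialComplex

/-! ### Proper, expanding, Lipschitz maps -/

/-- Two maps to a metric space diverge from one another if, for every `D`, their restrictions to the
complements of suitable compact sets have images at distance more than `D`. -/
def Diverge {X₁ X₂ Y : Type*} [TopologicalSpace X₁] [TopologicalSpace X₂] [MetricSpace Y]
    (h₁ : X₁ → Y) (h₂ : X₂ → Y) : Prop :=
  ∀ D : ℝ, 0 < D → ∃ C₁ : Set X₁, ∃ C₂ : Set X₂, IsCompact C₁ ∧ IsCompact C₂ ∧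
    ∀ x₁ ∉ C₁, ∀ x₂ ∉ C₂, D < dist (h₁ x₁) (h₂ x₂)

namespace AbstractSimplicialComplex

/-- The `0`-skeleton of the subcomplex `cone σ` of `cone K`. -/
def coneOn {V : Type*} (K : AbstractSimplicialComplex V) (σ : Finset V) : Set K.ConeVertex :=
  {x | x.1.support ⊆ σ}

/-- A map on the `0`-skeleton of `cone K` is expanding if its restrictions to the `0`-skeleta of
`cone σ` and `cone τ` diverge for any two disjoint simplices `σ` and `τ` of `K`. -/
def IsExpanding {V Y : Type*} [MetricSpace Y] (K : AbstractSimplicialComplex V)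
    (h : K.ConeVertex → Y) : Prop :=
  ∀ σ ∈ K, ∀ τ ∈ K, Disjoint σ τ → Diverge ((K.coneOn σ).domRestrict h) ((K.coneOn τ).domRestrict h)

/-- There is a proper, expanding, Lipschitz map from the `0`-skeleton of `cone K` to `Y`. -/
def SubsetBoundary {V : Type*} (K : AbstractSimplicialComplex V) (Y : Type*) [MetricSpace Y] :
    Prop :=
  ∃ h : K.ConeVertex → Y, IsProperMap h ∧ K.IsExpanding h ∧ ∃ C : NNReal, LipschitzWith C h

end AbstractSimplicialComplex

/-! Each irreducible spherical `T` has a central element `z_T` of its special Artin subgroup, the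
square of the Garside element. It is pure, that is, trivial in `W`. If `T` and `T'` are comparable
or orthogonal then `z_T` and `z_T'` commute, so a nested set generates an abelian subgroup. The map
`coneMap` sends `x` to the product, in a fixed order, of the powers of `z_T` with exponent `x (T, 1)
- x (T, -1)`.

It is Lipschitz because adjacent points lie in a common orthant, where the map is additive: their
images differ by right multiplication by one of finitely many elements (`exists_coneMap_eq_mul`).

Properness and expansion come from the inversion cocycle, with values in the functions on `W`. It is
additive on the pure Artin group, so it does not see that the `z_T` need not commute. Positive words
have nonnegative cocycle, and that of `z_T` is nonzero at some reflection `r_T` of full support in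
`W_T`, where the cocycle of `z_T'` vanishes unless `T ⊆ T'`. By triangularity the cocycle determines
all exponents (`centralProd_exponent_unique`). Hence, if `(coneMap x)⁻¹ * coneMap y` stays in a
finite set, so do the exponent differences; and if `x` and `y` have disjoint supports nothing
cancels in these differences, which bounds `x` (`coneVertex_le_abs_sub`).

The elements `z_T` and `r_T` come from the geometric representation. Positivity of roots
(`geomRep_nonneg`) yields Matsumoto's theorem and the properties of longest elements, hence the
Garside squares; the coordinates of a root tell which special subgroups contain its reflection. -/

/-! ### The geometric representation of a Coxeter group -/

namespace CoxeterMatrix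

variable {B : Type*} (M : CoxeterMatrix B)

/-- The linear form `v ↦ 2 B(α_s, v)` on the space with basis the simple roots. The convention
`π / 0 = 0` gives the value `-2` on `α_t` when `m_{st} = ∞`. -/
noncomputable def coroot (s : B) : Module.Dual ℝ (B →₀ ℝ) :=
  Finsupp.linearCombination ℝ fun t => -2 * Real.cos (Real.pi / M s t)

theorem coroot_single (s t : B) :
    M.coroot s (Finsupp.single t 1) = -2 * Real.cos (Real.pi / M s t) := by
  simp [coroot]

theorem coroot_self (s : B) : M.coroot s (Finsupp.single s 1) = 2 := by
  simp [coroot_single]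

theorem two_le_of_ne {s t : B} (hst : s ≠ t) (h0 : M s t ≠ 0) : 2 ≤ M s t := by
  have := M.off_diagonal s t hst
  omega

/-- The reflection of the geometric representation associated to a generator. -/
noncomputable def geomReflection (s : B) : (B →₀ ℝ) ≃ₗ[ℝ] (B →₀ ℝ) :=
  Module.reflection (M.coroot_self s)

theorem geomReflection_apply (s : B) (v : B →₀ ℝ) :
    M.geomReflection s v = v - M.coroot s v • Finsupp.single s 1 :=
  Module.reflection_apply _ _

open Polynomial.Chebyshev in
-- Powers of a product of two reflections are given by Chebyshev polynomials at `2 cos θ`, `θ =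
-- 2π/m`, with `S_n = sin((n+1)θ) / sin θ`. If `m = 2k`, then `S_{k-1}` vanishes since `kθ = π`; if
-- `m = 2k+1`, then `S_k + S_{k-1}` vanishes since `(k+1)θ = 2π - kθ`. For `m = 2` one has `sin θ =
-- 0`, and the identity is checked directly.
theorem isLiftable_geomReflection : M.IsLiftable M.geomReflection := by
  intro s t
  rcases eq_or_ne s t with rfl | hst
  · rw [M.diagonal, pow_one]
    ext1 v
    exact Module.involutive_reflection (M.coroot_self s) v
  rcases eq_or_ne (M s t) 0 with h0 | h0
  · rw [h0, pow_zero]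
  have h2 := M.two_le_of_ne hst h0
  have hs : M.coroot s (Finsupp.single t 1) = -2 * Real.cos (Real.pi / M s t) :=
    M.coroot_single s t
  have ht : M.coroot t (Finsupp.single s 1) = -2 * Real.cos (Real.pi / M s t) := by
    rw [M.coroot_single, M.symmetric]
  ext1 v
  unfold geomReflection
  rw [Module.reflection_mul_reflection_pow_apply (M.coroot_self s) (M.coroot_self t) (M s t) v
    (2 * Real.cos (2 * Real.pi / M s t))
    (by rw [hs, ht, mul_div_assoc, Real.cos_two_mul]; ring), LinearEquiv.coe_one, id_eq]
  generalize M s t = m at *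
  set θ : ℝ := 2 * Real.pi / m with hθ
  have hm : (m : ℝ) * θ = 2 * Real.pi := by
    rw [hθ]; field_simp
  rcases h2.eq_or_lt with rfl | h3
  · norm_num at hs ht
    have hc : (2 * Real.cos θ) = -2 := by rw [hθ]; norm_num
    norm_num [hc, hs, ht, S_neg_one, S_zero, S_one]
    abel
  have hsin : Real.sin θ ≠ 0 := by
    have h3' : (3 : ℝ) ≤ m := by exact_mod_cast h3
    refine (Real.sin_pos_of_pos_of_lt_pi (by positivity) ?_).ne'
    rw [hθ, div_lt_iff₀ (by linarith)]
    nlinarith [Real.pi_pos]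
  have hS (n : ℤ) : (S ℝ n).eval (2 * Real.cos θ) = Real.sin ((n + 1) * θ) / Real.sin θ := by
    rw [eq_div_iff hsin, S_two_mul_real_cos]
  obtain ⟨k, hk | hk⟩ := m.even_or_odd'
  · have e1 : ((m : ℤ) - 2) / 2 = k - 1 := by omega
    have e2 : ((m : ℤ) - 1) / 2 = k - 1 := by omega
    have hz : (S ℝ ((k : ℤ) - 1)).eval (2 * Real.cos θ) = 0 := by
      rw [hS]
      have : (((k : ℤ) - 1 : ℤ) + 1 : ℝ) * θ = Real.pi := by
        rw [hk] at hm; push_cast at hm ⊢; linarith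
      rw [this]; simp
    rw [e1, e2, hz]; simp
  · have e1 : ((m : ℤ) - 2) / 2 = k - 1 := by omega
    have e2 : ((m : ℤ) - 1) / 2 = k := by omega
    have e3 : ((m : ℤ) - 3) / 2 = k - 1 := by omega
    have e4 : (m : ℤ) / 2 = k := by omega
    have hz : (S ℝ (k : ℤ)).eval (2 * Real.cos θ) +
        (S ℝ ((k : ℤ) - 1)).eval (2 * Real.cos θ) = 0 := by
      rw [hS, hS, ← add_div]
      have : (((k : ℤ) : ℝ) + 1) * θ = 2 * Real.pi - (((k : ℤ) - 1 : ℤ) + 1 : ℝ) * θ := by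
        rw [hk] at hm; push_cast at hm ⊢; linarith
      rw [this, Real.sin_two_pi_sub]; simp
    rw [e1, e2, e3, e4, hz]; simp

end CoxeterMatrix

/-! ### Coefficients of the roots of dihedral subgroups -/

/-- The sequence `sin (n θ) / sin θ`, extended continuously to `θ = 0`. -/
noncomputable def sinRatio (θ : ℝ) : ℕ → ℝ
  | 0 => 0
  | 1 => 1
  | n + 2 => 2 * Real.cos θ * sinRatio θ (n + 1) - sinRatio θ n

theorem sin_mul_sinRatio (θ : ℝ) : ∀ n : ℕ, Real.sin θ * sinRatio θ n = Real.sin (n * θ)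
  | 0 => by simp [sinRatio]
  | 1 => by simp [sinRatio]
  | n + 2 => by
    have h1 := sin_mul_sinRatio θ (n + 1)
    have h0 := sin_mul_sinRatio θ n
    have e2 : ((n + 2 : ℕ) : ℝ) * θ = (n + 1 : ℕ) * θ + θ := by push_cast; ring
    have e0 : (n : ℝ) * θ = (n + 1 : ℕ) * θ - θ := by push_cast; ring
    rw [e0, Real.sin_sub] at h0
    rw [e2, Real.sin_add]
    simp only [sinRatio]
    linear_combination 2 * Real.cos θ * h1 - h0

theorem sinRatio_zero_left : ∀ n : ℕ, sinRatio 0 n = n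
  | 0 => by simp [sinRatio]
  | 1 => by simp [sinRatio]
  | n + 2 => by
    simp only [sinRatio, sinRatio_zero_left (n + 1), sinRatio_zero_left n]
    push_cast; rw [Real.cos_zero]; ring

/-- When `m = 0` (infinite order) the angle is `π / 0 = 0` and the value is `n`. Otherwise `π/m`
lies in `(0, π)` and `nπ/m` in `[0, π]`. -/
theorem sinRatio_nonneg {m n : ℕ} (hm : m ≠ 1) (h : m = 0 ∨ n ≤ m) :
    0 ≤ sinRatio (Real.pi / m) n := by
  rcases Nat.eq_zero_or_pos m with rfl | h0
  · simp [sinRatio_zero_left]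
  have h2 : (2 : ℝ) ≤ m := by exact_mod_cast (show 2 ≤ m by omega)
  have hn : (n : ℝ) ≤ m := by exact_mod_cast (show n ≤ m by omega)
  have hs : 0 < Real.sin (Real.pi / m) := by
    apply Real.sin_pos_of_pos_of_lt_pi (by positivity)
    rw [div_lt_iff₀ (by linarith)]
    nlinarith [Real.pi_pos]
  have : 0 ≤ Real.sin (n * (Real.pi / m)) := by
    apply Real.sin_nonneg_of_nonneg_of_le_pi (by positivity)
    rw [← mul_div_assoc, div_le_iff₀ (by linarith)]
    nlinarith [Real.pi_pos]
  rw [← sin_mul_sinRatio] at this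
  exact nonneg_of_mul_nonneg_right this hs

/-! ### Positive and negative roots -/

namespace CoxeterSystem

variable {B W : Type*} [Group W] {M : CoxeterMatrix B} (cs : CoxeterSystem M W)

/-- The geometric representation. -/
noncomputable def geomRep : W →* ((B →₀ ℝ) ≃ₗ[ℝ] (B →₀ ℝ)) :=
  cs.lift ⟨M.geomReflection, M.isLiftable_geomReflection⟩

theorem geomRep_simple (s : B) (v : B →₀ ℝ) :
    cs.geomRep (cs.simple s) v = v - M.coroot s v • Finsupp.single s 1 := by
  rw [geomRep, cs.lift_apply_simple, M.geomReflection_apply]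

theorem geomRep_simple_self (s : B) :
    cs.geomRep (cs.simple s) (Finsupp.single s 1) = -Finsupp.single s 1 := by
  rw [geomRep_simple, M.coroot_self]; module

theorem geomRep_mul_apply (w w' : W) (v : B →₀ ℝ) :
    cs.geomRep (w * w') v = cs.geomRep w (cs.geomRep w' v) := by
  rw [map_mul]; rfl

theorem geomRep_mul_simple_self (w : W) (s : B) :
    cs.geomRep (w * cs.simple s) (Finsupp.single s 1) =
      -cs.geomRep w (Finsupp.single s 1) := by
  rw [geomRep_mul_apply, geomRep_simple_self, map_neg]

theorem geomRep_root_ne_zero (w : W) (s : B) : cs.geomRep w (Finsupp.single s 1) ≠ 0 := by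
  simp

theorem simple_injective : Function.Injective cs.simple := by
  intro s t h
  by_contra hst
  have h1 := cs.geomRep_simple_self s
  rw [h, geomRep_simple] at h1
  have := DFunLike.congr_fun h1 s
  simp [Ne.symm hst] at this
  norm_num at this

/-- The special subgroup generated by a set of simple reflections. -/
def specialSubgroup (T : Set B) : Subgroup W := Subgroup.closure (cs.simple '' T)

variable {cs} in
theorem simple_mem_specialSubgroup {T : Set B} {s : B} (hs : s ∈ T) :
    cs.simple s ∈ cs.specialSubgroup T :=
  Subgroup.subset_closure ⟨s, hs, rfl⟩

theorem wordProd_mem_specialSubgroup {T : Set B} {ω : List B} (h : ∀ s ∈ ω, s ∈ T) :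
    cs.wordProd ω ∈ cs.specialSubgroup T := by
  refine Subgroup.list_prod_mem _ fun x hx => ?_
  obtain ⟨s, hs, rfl⟩ := List.mem_map.1 hx
  exact simple_mem_specialSubgroup (h s hs)

variable {cs} in
-- A generator `s` only adds a multiple of the simple root `α_s`. This is the test used below to
-- show that a generator belongs to `T`.
theorem geomRep_apply_of_notMem {T : Set B} {w : W} (hw : w ∈ cs.specialSubgroup T) {t : B}
    (ht : t ∉ T) (v : B →₀ ℝ) : cs.geomRep w v t = v t := by
  induction hw using Subgroup.closure_induction generalizing v with
  | mem x hx =>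
    obtain ⟨s, hs, rfl⟩ := hx
    have : s ≠ t := fun h => ht (h ▸ hs)
    simp [geomRep_simple, this]
  | one => simp
  | mul x y _ _ hx hy => rw [geomRep_mul_apply, hx, hy]
  | inv x _ hx =>
    rw [← hx, ← geomRep_mul_apply, mul_inv_cancel, map_one]; rfl

theorem geomRep_alternatingWord {s t : B} (k : ℕ) :
    cs.geomRep (cs.wordProd (alternatingWord s t k)) (Finsupp.single s 1) =
      if Even k then sinRatio (Real.pi / M s t) (k + 1) • Finsupp.single s 1 +
          sinRatio (Real.pi / M s t) k • Finsupp.single t 1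
        else sinRatio (Real.pi / M s t) (k + 1) • Finsupp.single t 1 +
          sinRatio (Real.pi / M s t) k • Finsupp.single s 1 := by
  induction k with
  | zero => simp [alternatingWord, sinRatio]
  | succ k ih =>
    have hs := M.coroot_single s t
    have ht := M.coroot_single t s
    rw [M.symmetric t s] at ht
    rw [alternatingWord_succ', wordProd_cons, geomRep_mul_apply, ih]
    by_cases hk : Even k
    · simp only [hk, if_true, Nat.even_add_one, not_true, if_false, geomRep_simple, map_add,
        map_smul, ht, M.coroot_self, sinRatio]
      module
    · simp only [hk, if_true, Nat.even_add_one, not_false_iff, if_false, geomRep_simple, map_add,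
        map_smul, hs, M.coroot_self, sinRatio]
      module

theorem exists_geomRep_alternatingWord_eq {s t : B} (hst : s ≠ t) {k : ℕ}
    (hk : M s t = 0 ∨ k < M s t) : ∃ a b : ℝ, 0 ≤ a ∧ 0 ≤ b ∧
      cs.geomRep (cs.wordProd (alternatingWord s t k)) (Finsupp.single s 1) =
        a • Finsupp.single s 1 + b • Finsupp.single t 1 := by
  have h1 := M.off_diagonal s t hst
  have ha : 0 ≤ sinRatio (Real.pi / M s t) (k + 1) := sinRatio_nonneg h1 (by omega)
  have hb : 0 ≤ sinRatio (Real.pi / M s t) k := sinRatio_nonneg h1 (by omega)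
  rw [geomRep_alternatingWord]
  split_ifs
  · exact ⟨_, _, ha, hb, rfl⟩
  · exact ⟨_, _, hb, ha, add_comm _ _⟩

/-- The longest alternating suffix ending in `t` is split off with lengths adding up; what remains
is minimal in its coset of the dihedral subgroup. -/
theorem exists_eq_mul_alternatingWord {w : W} {s t : B} (ht : cs.IsRightDescent w t) :
    ∃ (k : ℕ) (v : W), 0 < k ∧ w = v * cs.wordProd (alternatingWord s t k) ∧
      cs.length w = cs.length v + k ∧ ¬ cs.IsRightDescent v s ∧ ¬ cs.IsRightDescent v t := by
  classical
  let Q : ℕ → Prop := fun k => ∃ v : W, w = v * cs.wordProd (alternatingWord s t k) ∧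
    cs.length w = cs.length v + k
  have hQ1 : Q 1 := ⟨w * cs.simple t, by simp [alternatingWord], by
    rw [(cs.isRightDescent_iff).1 ht]⟩
  have hle : ∀ k, Q k → k ≤ cs.length w := by
    rintro k ⟨v, -, hv⟩; omega
  set k := Nat.findGreatest Q (cs.length w) with hkdef
  have hk1 : 1 ≤ k := Nat.le_findGreatest (hle 1 hQ1) hQ1
  obtain ⟨v, hwv, hlen⟩ : Q k := Nat.findGreatest_spec (hle 1 hQ1) hQ1
  have hmax : ¬ Q (k + 1) := fun h => by
    have := Nat.le_findGreatest (hle _ h) h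
    omega
  -- The first letter `u` of the suffix: if it were a descent of `v`, cancelling it would write `w`
  -- with fewer than `ℓ(w)` letters.
  have key : ∀ (u : B) (n : ℕ) (ρ : List B), ρ.length = n →
      cs.wordProd (alternatingWord s t k) = cs.simple u * cs.wordProd ρ → n + 1 = k →
      ¬ cs.IsRightDescent v u := by
    intro u n ρ hρ hu hn hd
    rw [isRightDescent_iff] at hd
    have h1 : w = v * cs.simple u * cs.wordProd ρ := by rw [hwv, hu, mul_assoc]
    have h2 := cs.length_mul_le (v * cs.simple u) (cs.wordProd ρ)
    have h3 := cs.length_wordProd_le ρ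
    rw [← h1] at h2
    omega
  -- The other letter: if it were a descent of `v`, the suffix could be lengthened.
  have key' : ∀ u : B, alternatingWord s t (k + 1) = u :: alternatingWord s t k →
      ¬ cs.IsRightDescent v u := by
    intro u hu hd
    refine hmax ⟨v * cs.simple u, ?_, ?_⟩
    · rw [hu, wordProd_cons, mul_assoc, simple_mul_simple_cancel_left, hwv]
    · rw [isRightDescent_iff] at hd; omega
  obtain ⟨n, hn⟩ : ∃ n, k = n + 1 := ⟨k - 1, by omega⟩
  refine ⟨k, v, hk1, hwv, hlen, ?_⟩
  have e1 := alternatingWord_succ' s t k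
  have e2 := alternatingWord_succ' s t n
  have e3 := congrArg cs.wordProd e2
  rw [wordProd_cons, ← hn] at e3
  by_cases hev : Even n
  · have : ¬ Even k := by rw [hn, Nat.even_add_one]; exact not_not.2 hev
    rw [if_neg this] at e1
    rw [if_pos hev] at e3
    exact ⟨key' s e1, key t n _ (by simp) e3 hn.symm⟩
  · have : Even k := by rw [hn, Nat.even_add_one]; exact hev
    rw [if_pos this] at e1
    rw [if_neg hev] at e3
    exact ⟨key s n _ (by simp) e3 hn.symm, key' t e1⟩

/-- If `s` is not a right descent of `w`, then `w α_s` is a positive root. -/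
theorem geomRep_nonneg {w : W} {s : B} (hs : ¬ cs.IsRightDescent w s) :
    0 ≤ cs.geomRep w (Finsupp.single s 1) := by
  induction hn : cs.length w using Nat.strong_induction_on generalizing w s with
  | h n ih =>
    rcases eq_or_ne w 1 with rfl | hw
    · rw [map_one]; exact Finsupp.single_nonneg.2 zero_le_one
    obtain ⟨t, ht⟩ := cs.exists_rightDescent_of_ne_one hw
    have hst : s ≠ t := fun h => hs (h ▸ ht)
    obtain ⟨k, v, hk, hwv, hlen, hvs, hvt⟩ := cs.exists_eq_mul_alternatingWord (s := s) ht
    -- Since `s` is not a descent of `w`, the alternating word of length `k + 1` is reduced, so `k +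
    -- 1` cannot exceed a finite `m_{st}`.
    have hkM : M s t = 0 ∨ k < M s t := by
      by_contra! hcon
      rw [not_isRightDescent_iff] at hs
      refine cs.not_isReduced_alternatingWord t s (m := k + 1) (by rw [M.symmetric]; exact hcon.1)
        (by rw [M.symmetric]; omega) ?_
      have h1 : w * cs.simple s = v * cs.wordProd (alternatingWord t s (k + 1)) := by
        rw [alternatingWord_succ, wordProd_concat, ← mul_assoc, hwv]
      have h2 := cs.length_mul_le v (cs.wordProd (alternatingWord t s (k + 1)))
      have h3 := cs.length_wordProd_le (alternatingWord t s (k + 1))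
      rw [← h1] at h2
      rw [IsReduced]
      rw [length_alternatingWord] at h3 ⊢
      omega
    obtain ⟨a, b, ha, hb, hab⟩ := cs.exists_geomRep_alternatingWord_eq hst hkM
    rw [hwv, geomRep_mul_apply, hab, map_add, map_smul, map_smul]
    exact add_nonneg (smul_nonneg ha (ih _ (by omega) hvs rfl))
      (smul_nonneg hb (ih _ (by omega) hvt rfl))

theorem geomRep_nonpos {w : W} {s : B} (hs : cs.IsRightDescent w s) :
    cs.geomRep w (Finsupp.single s 1) ≤ 0 := by
  rw [isRightDescent_iff_not_isRightDescent_mul] at hs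
  have := cs.geomRep_nonneg hs
  rwa [geomRep_mul_simple_self, Left.nonneg_neg_iff] at this

theorem isRightDescent_of_geomRep_nonpos {w : W} {s : B}
    (h : cs.geomRep w (Finsupp.single s 1) ≤ 0) : cs.IsRightDescent w s := by
  by_contra hs
  exact cs.geomRep_root_ne_zero w s (le_antisymm h (cs.geomRep_nonneg hs))

end CoxeterSystem

/-! ### Matsumoto's theorem and Garside elements -/

namespace CoxeterSystem

open CoxeterMatrix

variable {B W : Type*} [Group W] {M : CoxeterMatrix B} (cs : CoxeterSystem M W)

theorem prod_map_alternatingWord {G : Type*} [Monoid G] (f : B → G) (s t : B) (n : ℕ) :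
    ((alternatingWord s t n).map f).prod =
      if Even n then altProd (f s) (f t) n else altProd (f t) (f s) n := by
  induction n with
  | zero => simp [alternatingWord, altProd]
  | succ n ih =>
    rw [alternatingWord_succ', List.map_cons, List.prod_cons, ih]
    by_cases hn : Even n
    · simp [hn, Nat.even_add_one, altProd]
    · simp [hn, Nat.even_add_one, altProd]

theorem reverse_alternatingWord (s t : B) (n : ℕ) :
    (alternatingWord s t n).reverse =
      if Even n then alternatingWord t s n else alternatingWord s t n := by
  induction n generalizing s t with
  | zero => simp [alternatingWord]
  | succ n ih =>
    rw [alternatingWord_succ, List.concat_eq_append, List.reverse_append, ih]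
    by_cases hn : Even n
    · rw [if_pos hn, if_neg (by simpa [Nat.even_add_one] using hn)]
      conv_rhs => rw [← List.concat_eq_append, ← alternatingWord_succ, alternatingWord_succ',
        if_pos hn]
      rfl
    · rw [if_neg hn, if_pos (by simpa [Nat.even_add_one] using hn), alternatingWord_succ' t s,
        if_neg hn]
      rfl

/-- The alternating product of length `m_{st}` is an involution. -/
theorem wordProd_alternatingWord_mul_self (s t : B) :
    cs.wordProd (alternatingWord s t (M s t)) * cs.wordProd (alternatingWord s t (M s t)) = 1 := by
  have h : cs.wordProd (alternatingWord s t (M s t)).reverse =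
      cs.wordProd (alternatingWord s t (M s t)) := by
    rw [reverse_alternatingWord]
    split_ifs
    · have := cs.wordProd_braidWord_eq t s
      rwa [braidWord, braidWord, M.symmetric t s] at this
    · rfl
  rw [wordProd_reverse] at h
  nth_rw 1 [← h]
  exact inv_mul_cancel _

/-- Since `w` makes `α_s` and `α_t` negative, it makes every nonnegative combination of them
negative. The roots met along an alternating word are such combinations, so every letter shortens.
-/
theorem length_mul_alternatingWord {w : W} {s t : B} (hst : s ≠ t) (hs : cs.IsRightDescent w s)
    (ht : cs.IsRightDescent w t) {k : ℕ} (hk : M s t = 0 ∨ k ≤ M s t) :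
    cs.length (w * cs.wordProd (alternatingWord s t k)) + k = cs.length w := by
  induction k generalizing s t with
  | zero => simp [alternatingWord]
  | succ k ih =>
    have hts : M t s = 0 ∨ k < M t s := by rw [M.symmetric]; omega
    have ihk := ih hst.symm ht hs (by omega)
    obtain ⟨a, b, ha, hb, hab⟩ := cs.exists_geomRep_alternatingWord_eq hst.symm hts
    have hd : cs.IsRightDescent (w * cs.wordProd (alternatingWord t s k)) t := by
      apply isRightDescent_of_geomRep_nonpos
      rw [geomRep_mul_apply, hab, map_add, map_smul, map_smul]
      exact add_nonpos (smul_nonpos_of_nonneg_of_nonpos ha (cs.geomRep_nonpos ht))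
        (smul_nonpos_of_nonneg_of_nonpos hb (cs.geomRep_nonpos hs))
    rw [isRightDescent_iff] at hd
    rw [alternatingWord_succ, wordProd_concat, ← mul_assoc]
    omega

/-- If `m_{st} = ∞`, the length of `w` would drop indefinitely. Otherwise a full braid word splits
off on the right, which allows a braid move in Matsumoto's theorem. -/
theorem exists_eq_mul_braidWord {w : W} {s t : B} (hst : s ≠ t) (hs : cs.IsRightDescent w s)
    (ht : cs.IsRightDescent w t) : ∃ v : W, M s t ≠ 0 ∧
      w = v * cs.wordProd (alternatingWord s t (M s t)) ∧ cs.length w = cs.length v + M s t := by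
  refine ⟨w * cs.wordProd (alternatingWord s t (M s t)), fun h0 => ?_, ?_,
    (cs.length_mul_alternatingWord hst hs ht (Or.inr le_rfl)).symm⟩
  · have := cs.length_mul_alternatingWord hst hs ht (k := cs.length w + 1) (Or.inl h0)
    omega
  · rw [mul_assoc, wordProd_alternatingWord_mul_self, mul_one]

theorem isReduced_of_concat {ω : List B} {s : B} (h : cs.IsReduced (ω.concat s)) :
    cs.IsReduced ω ∧ cs.IsRightDescent (cs.wordProd (ω.concat s)) s := by
  have h1 : cs.IsReduced ω := by simpa using h.take ω.length
  refine ⟨h1, ?_⟩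
  rw [isRightDescent_iff, h.eq, wordProd_concat, simple_mul_simple_cancel_right, h1.eq]
  simp

/-- **Matsumoto's theorem**: if the images of the generators satisfy the braid relations, then the
product along a reduced word depends only on the element of the Coxeter group. -/
theorem prod_map_eq_of_isReduced {G : Type*} [Monoid G] {f : B → G}
    (hf : ∀ s t, altProd (f s) (f t) (M s t) = altProd (f t) (f s) (M s t)) {ω ω' : List B}
    (h : cs.IsReduced ω) (h' : cs.IsReduced ω') (heq : cs.wordProd ω = cs.wordProd ω') :
    (ω.map f).prod = (ω'.map f).prod := by
  induction hn : ω.length generalizing ω ω' with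
  | zero =>
    have h1 : ω'.length = 0 := by rw [← h'.eq, ← heq, h.eq, hn]
    rw [List.length_eq_zero_iff.1 hn, List.length_eq_zero_iff.1 h1]
  | succ n ih =>
    have hn' : ω'.length = n + 1 := by rw [← h'.eq, ← heq, h.eq, hn]
    obtain rfl | ⟨ω₁, s, rfl⟩ := List.eq_nil_or_concat ω
    · simp at hn
    obtain rfl | ⟨ω₂, t, rfl⟩ := List.eq_nil_or_concat ω'
    · simp at hn'
    rw [List.length_concat, Nat.add_right_cancel_iff] at hn hn'
    obtain ⟨h₁, hs⟩ := cs.isReduced_of_concat h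
    obtain ⟨h₂, ht⟩ := cs.isReduced_of_concat h'
    rcases eq_or_ne s t with rfl | hst
    · rw [wordProd_concat, wordProd_concat, mul_left_inj] at heq
      simp [ih h₁ h₂ heq hn]
    obtain ⟨v, hm, hv, hlen⟩ := cs.exists_eq_mul_braidWord hst hs (heq ▸ ht)
    obtain ⟨ρ, hρ, rfl⟩ := cs.exists_isReduced v
    -- By induction, a reduced word ending in `y` has the same product as `ρ` followed by the braid
    -- word ending in `y`. The two braid words, ending in `s` and in `t`, agree by `hf`.
    have key : ∀ (x y : B) (τ : List B), cs.IsReduced (τ.concat y) →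
        cs.IsReduced τ → τ.length = n →
        cs.wordProd (τ.concat y) = cs.wordProd ρ * cs.wordProd (alternatingWord x y (M s t)) →
        cs.length (cs.wordProd (τ.concat y)) = cs.length (cs.wordProd ρ) + M s t →
        ((τ.concat y).map f).prod =
          (ρ.map f).prod * ((alternatingWord x y (M s t)).map f).prod := by
      intro x y τ hred hτ hτn hprod hl
      obtain ⟨k, hk⟩ := Nat.exists_eq_succ_of_ne_zero hm
      rw [hk, alternatingWord_succ] at hprod ⊢
      rw [wordProd_concat, wordProd_concat, ← mul_assoc, mul_left_inj, ← wordProd_append] at hprod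
      have hred' : cs.IsReduced (ρ ++ alternatingWord y x k) := by
        rw [IsReduced, ← hprod, hτ.eq, List.length_append, length_alternatingWord]
        rw [hred.eq, hρ.eq, List.length_concat, hk] at hl
        omega
      have := ih hτ hred' hprod hτn
      simp only [List.concat_eq_append, List.map_append, List.prod_append] at this ⊢
      rw [this, mul_assoc]
    have hbr := cs.wordProd_braidWord_eq s t
    rw [braidWord, braidWord, M.symmetric t s] at hbr
    rw [key t s ω₁ h h₁ hn (by rw [hv, hbr]) hlen,
      key s t ω₂ h' h₂ hn' (by rw [← heq, hv]) (by rw [← heq, hlen]),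
      prod_map_alternatingWord, prod_map_alternatingWord, hf s t]

variable {cs} in
/-- A reduced word of an element of a special subgroup only uses letters of that subgroup. -/
theorem IsReduced.mem_of_wordProd_mem {T : Set B} {ω : List B} (h : cs.IsReduced ω)
    (hT : cs.wordProd ω ∈ cs.specialSubgroup T) : ∀ s ∈ ω, s ∈ T := by
  induction ω using List.reverseRecOn with
  | nil => simp
  | append_singleton ω s ih =>
    rw [← List.concat_eq_append] at h hT
    obtain ⟨h₁, hs⟩ := cs.isReduced_of_concat h
    -- Otherwise the root, which is negative, would keep the coefficient `1` of `α_s`.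
    have hsT : s ∈ T := by
      by_contra hsT
      have h1 := cs.geomRep_nonpos hs s
      rw [geomRep_apply_of_notMem hT hsT] at h1
      norm_num at h1
    have hω : cs.wordProd ω ∈ cs.specialSubgroup T := by
      rw [wordProd_concat] at hT
      exact (Subgroup.mul_mem_cancel_right _ (simple_mem_specialSubgroup hsT)).1 hT
    intro t ht
    rcases List.mem_append.1 ht with ht | ht
    · exact ih h₁ hω t ht
    · rw [List.mem_singleton.1 ht]; exact hsT

/-! ### Longest elements and central words -/

variable {cs} in
-- An element of maximal length in the finite group `W_T` works.
theorem IsSpherical.exists_forall_isRightDescent {T : Set B} (hT : cs.IsSpherical T) :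
    ∃ w ∈ cs.specialSubgroup T, ∀ s ∈ T, cs.IsRightDescent w s := by
  have : Finite (cs.specialSubgroup T) := hT
  obtain ⟨w, hw⟩ := Finite.exists_max fun w : cs.specialSubgroup T => cs.length w.1
  refine ⟨w, w.2, fun s hs => ?_⟩
  have h1 := hw ⟨w * cs.simple s, mul_mem w.2 (simple_mem_specialSubgroup hs)⟩
  exact lt_of_le_of_ne h1 (cs.length_mul_simple_ne _ _)

variable {cs} in
theorem geomRep_nonpos_of_forall_isRightDescent {T : Set B} {w : W}
    (hw : ∀ s ∈ T, cs.IsRightDescent w s) {v : B →₀ ℝ} (hv : 0 ≤ v) (hvT : ∀ t ∉ T, v t = 0) :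
    cs.geomRep w v ≤ 0 := by
  have h : v = ∑ t ∈ v.support, v t • Finsupp.single t 1 := by
    conv_lhs => rw [← Finsupp.sum_single v]
    simp [Finsupp.sum]
  rw [h, map_sum]
  refine Finset.sum_nonpos fun t ht => ?_
  rw [map_smul]
  refine smul_nonpos_of_nonneg_of_nonpos (hv t) (cs.geomRep_nonpos (hw t ?_))
  by_contra hcon
  exact (Finsupp.mem_support_iff.1 ht) (hvT t hcon)

variable {cs} in
-- Each new letter `s` of a reduced word of `x` comes with a positive root supported in `T`; `w`
-- makes it negative, so the letter shortens. For the longest element, `x = w` gives `w * w = 1` and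
-- `x = s * w` shows that `w` permutes the simple reflections of `T` by conjugation.
theorem length_mul_of_forall_isRightDescent {T : Set B} {w : W}
    (hw : ∀ s ∈ T, cs.IsRightDescent w s) {x : W} (hx : x ∈ cs.specialSubgroup T) :
    cs.length (w * x) + cs.length x = cs.length w := by
  obtain ⟨ω, hω, rfl⟩ := cs.exists_isReduced x
  have hωT := hω.mem_of_wordProd_mem hx
  clear hx
  induction ω using List.reverseRecOn with
  | nil => simp
  | append_singleton ω s ih =>
    rw [← List.concat_eq_append] at hω ⊢
    obtain ⟨h₁, hs⟩ := cs.isReduced_of_concat hω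
    have hωT' : ∀ t ∈ ω, t ∈ T := fun t ht => hωT t (by simp [ht])
    have hsT : s ∈ T := hωT s (by simp)
    have ih' := ih h₁ hωT'
    have hmem := wordProd_mem_specialSubgroup cs hωT'
    rw [wordProd_concat] at hs ⊢
    have hnd : ¬ cs.IsRightDescent (cs.wordProd ω) s := by
      rwa [isRightDescent_iff_not_isRightDescent_mul, simple_mul_simple_cancel_right] at hs
    have hd : cs.IsRightDescent (w * cs.wordProd ω) s := by
      apply isRightDescent_of_geomRep_nonpos
      rw [geomRep_mul_apply]
      refine geomRep_nonpos_of_forall_isRightDescent hw (cs.geomRep_nonneg hnd) fun t ht => ?_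
      rw [geomRep_apply_of_notMem hmem ht]
      exact Finsupp.single_eq_of_ne (fun h => ht (h ▸ hsT))
    rw [isRightDescent_iff] at hd
    rw [not_isRightDescent_iff] at hnd
    rw [← mul_assoc]
    omega

variable {cs} in
/-- The square of the Garside element of a spherical special subgroup, as a word. -/
theorem IsSpherical.exists_central_word {T : Set B} (hT : cs.IsSpherical T) (hne : T.Nonempty)
    {G : Type*} [Monoid G] {f : B → G}
    (hf : ∀ s t, altProd (f s) (f t) (M s t) = altProd (f t) (f s) (M s t)) :
    ∃ ω : List B, ω ≠ [] ∧ (∀ s ∈ ω, s ∈ T) ∧ cs.wordProd ω = 1 ∧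
      ∀ s ∈ T, Commute (ω.map f).prod (f s) := by
  obtain ⟨w, hw, hd⟩ := hT.exists_forall_isRightDescent
  obtain ⟨ω, hω, rfl⟩ := cs.exists_isReduced w
  have hωT := hω.mem_of_wordProd_mem hw
  set w := cs.wordProd ω with hwdef
  have hww : w * w = 1 := by
    have := length_mul_of_forall_isRightDescent hd hw
    exact cs.length_eq_zero_iff.1 (by omega)
  have hinv : w⁻¹ = w := inv_eq_of_mul_eq_one_right hww
  -- With `w s = j w` and `ρ` a reduced word of `w s`, both `ρ s` and `j ρ` are reduced words of
  -- `w`. By Matsumoto's theorem the lift `Δ` equals `ρ f(s)` and `f(j) ρ`, whence `Δ f(s) = f(j)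
  -- Δ`.
  have twist : ∀ s ∈ T, ∃ j ∈ T, w * cs.simple s = cs.simple j * w ∧
      (ω.map f).prod * f s = f j * (ω.map f).prod := by
    intro s hs
    have hld : cs.IsLeftDescent w s := by
      rw [← isRightDescent_inv_iff, hinv]; exact hd s hs
    rw [isLeftDescent_iff] at hld
    have hmem : cs.simple s * w ∈ cs.specialSubgroup T :=
      mul_mem (simple_mem_specialSubgroup hs) hw
    have hl := length_mul_of_forall_isRightDescent hd hmem
    obtain ⟨j, hj⟩ := cs.length_eq_one_iff.1 (show cs.length (w * (cs.simple s * w)) = 1 by omega)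
    have hjT : j ∈ T := by
      refine IsReduced.mem_of_wordProd_mem (cs := cs) (ω := [j]) ?_ ?_ j (by simp)
      · simp [IsReduced]
      · rw [wordProd_singleton, ← hj]; exact mul_mem hw hmem
    have hcomm : w * cs.simple s = cs.simple j * w := by
      rw [← hj, ← mul_assoc, mul_assoc _ w w, hww, mul_one]
    refine ⟨j, hjT, hcomm, ?_⟩
    obtain ⟨ρ, hρ, hρw⟩ := cs.exists_isReduced (w * cs.simple s)
    have hlen : ρ.length + 1 = cs.length w := by
      rw [← hρ.eq, ← hρw]; exact (cs.isRightDescent_iff).1 (hd s hs)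
    have e1 : cs.wordProd (ρ.concat s) = w := by
      rw [wordProd_concat, ← hρw, simple_mul_simple_cancel_right]
    have e2 : cs.wordProd (j :: ρ) = w := by
      rw [wordProd_cons, ← hρw, hcomm, simple_mul_simple_cancel_left]
    have r1 : cs.IsReduced (ρ.concat s) := by
      rw [IsReduced, e1, ← hlen, List.length_concat]
    have r2 : cs.IsReduced (j :: ρ) := by
      rw [IsReduced, e2, ← hlen, List.length_cons]
    have p1 := cs.prod_map_eq_of_isReduced hf hω r1 (e1 ▸ rfl)
    have p2 := cs.prod_map_eq_of_isReduced hf hω r2 (e2 ▸ rfl)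
    simp only [List.concat_eq_append, List.map_append, List.prod_append, List.map_cons,
      List.map_nil, List.prod_cons, List.prod_nil, mul_one] at p1 p2
    nth_rw 1 [p2]
    rw [p1, mul_assoc]
  refine ⟨ω ++ ω, ?_, ?_, ?_, ?_⟩
  · obtain ⟨s, hs⟩ := hne
    rintro h
    rw [List.append_eq_nil_iff] at h
    have := hd s hs
    rw [hwdef, h.1] at this
    exact cs.not_isRightDescent_one s this
  · intro s hs
    exact hωT s (by simpa using hs)
  · rw [wordProd_append, hww]
  · intro s hs
    obtain ⟨j, hj, hsj, hfj⟩ := twist s hs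
    obtain ⟨i, hi, hji, hfi⟩ := twist j hj
    -- Conjugating twice by the involution `w` is trivial, so the square of `Δ` commutes with `f s`.
    have his : i = s := by
      apply cs.simple_injective
      rw [← mul_left_inj w, ← hji, ← mul_right_inj w, ← mul_assoc, ← mul_assoc, hww, one_mul,
        hsj, mul_assoc, hww, mul_one]
    subst his
    rw [List.map_append, List.prod_append, commute_iff_eq, mul_assoc, hfj, ← mul_assoc,
      hfi, mul_assoc]

end CoxeterSystem

/-! ### Artin groups and their inversion cocycle -/

namespace CoxeterMatrix

variable {B : Type*} (M : CoxeterMatrix B)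

theorem map_altProd {G H : Type*} [Monoid G] [Monoid H] (φ : G →* H) (a b : G) (n : ℕ) :
    φ (altProd a b n) = altProd (φ a) (φ b) n := by
  induction n generalizing a b with
  | zero => simp [altProd]
  | succ n ih => simp [altProd, ih]

/-- The standard generators of an Artin group. -/
def artinGen (s : B) : M.ArtinGroup := PresentedGroup.of s

theorem artinGen_braid (s t : B) :
    altProd (M.artinGen s) (M.artinGen t) (M s t) =
      altProd (M.artinGen t) (M.artinGen s) (M s t) := by
  have h := PresentedGroup.one_of_mem (rels := M.artinRelators) ⟨s, t, rfl⟩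
  rw [map_mul, map_inv, mul_inv_eq_one, map_altProd, map_altProd] at h
  exact h

theorem commute_artinGen {s t : B} (h : M s t = 2) :
    Commute (M.artinGen s) (M.artinGen t) := by
  have := M.artinGen_braid s t
  rw [h] at this
  simpa [altProd, commute_iff_eq] using this

/-- The homomorphism from an Artin group determined by elements satisfying the braid relations. -/
def artinLift {G : Type*} [Group G] (f : B → G)
    (hf : ∀ s t, altProd (f s) (f t) (M s t) = altProd (f t) (f s) (M s t)) :
    M.ArtinGroup →* G :=
  PresentedGroup.toGroup (f := f) (by
    rintro _ ⟨s, t, rfl⟩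
    rw [map_mul, map_inv, mul_inv_eq_one, map_altProd, map_altProd]
    simpa using hf s t)

theorem artinLift_artinGen {G : Type*} [Group G] (f : B → G)
    (hf : ∀ s t, altProd (f s) (f t) (M s t) = altProd (f t) (f s) (M s t)) (s : B) :
    M.artinLift f hf (M.artinGen s) = f s :=
  PresentedGroup.toGroup.of _

theorem closure_range_artinGen : Subgroup.closure (Set.range M.artinGen) = ⊤ :=
  PresentedGroup.closure_range_of _

end CoxeterMatrix

namespace CoxeterSystem

open CoxeterMatrix

variable {B W : Type*} [Group W] {M : CoxeterMatrix B} (cs : CoxeterSystem M W)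

theorem altProd_simple_braid (s t : B) :
    altProd (cs.simple s) (cs.simple t) (M s t) = altProd (cs.simple t) (cs.simple s) (M s t) := by
  have h := cs.wordProd_braidWord_eq s t
  rw [braidWord, braidWord, M.symmetric t s, wordProd, wordProd, prod_map_alternatingWord,
    prod_map_alternatingWord] at h
  split_ifs at h
  · exact h
  · exact h.symm

/-- The projection of the Artin group onto the Coxeter group. -/
def artinProj : M.ArtinGroup →* W := M.artinLift cs.simple cs.altProd_simple_braid

theorem artinProj_artinGen (s : B) : cs.artinProj (M.artinGen s) = cs.simple s :=
  M.artinLift_artinGen _ _ s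

theorem simple_conj_eq_iff {s : B} {r : W} :
    cs.simple s * r * cs.simple s = cs.simple s ↔ r = cs.simple s := by
  constructor
  · intro h
    have := congrArg (fun x => cs.simple s * x * cs.simple s) h
    simpa [mul_assoc] using this
  · rintro rfl; simp

open Classical in
/-- The affine permutation `v ↦ s • v + e_s` of the functions on the Coxeter group, which is acted on
by conjugation. -/
noncomputable def affineReflection (s : B) : Equiv.Perm (W → ℤ) where
  toFun v r := v (cs.simple s * r * cs.simple s) + if r = cs.simple s then 1 else 0
  invFun v r := v (cs.simple s * r * cs.simple s) - if r = cs.simple s then 1 else 0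
  left_inv v := by
    ext r
    simp only [simple_conj_eq_iff]
    simp [mul_assoc]
  right_inv v := by
    ext r
    simp only [simple_conj_eq_iff]
    simp [mul_assoc]

open Classical in
theorem affineReflection_apply (s : B) (v : W → ℤ) (r : W) :
    cs.affineReflection s v r =
      v (cs.simple s * r * cs.simple s) + if r = cs.simple s then 1 else 0 := rfl

open Classical in
-- The factor preceded by `i` others adds the indicator of its own reflection, conjugated by those
-- `i` factors; this conjugate is the alternating word of length `2i + 1`.
theorem altProd_affineReflection_apply (s t : B) (n : ℕ) (v : W → ℤ) (r : W) :
    altProd (cs.affineReflection s) (cs.affineReflection t) n v r =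
      v ((altProd (cs.simple s) (cs.simple t) n)⁻¹ * r * altProd (cs.simple s) (cs.simple t) n) +
        ∑ i ∈ Finset.range n,
          if r = altProd (cs.simple s) (cs.simple t) (2 * i + 1) then 1 else 0 := by
  induction n generalizing s t r with
  | zero => simp [altProd]
  | succ n ih =>
    rw [altProd, Equiv.Perm.mul_apply, affineReflection_apply, ih, Finset.sum_range_succ',
      ← add_assoc]
    congr 2
    · simp [altProd, mul_assoc]
    · refine Finset.sum_congr rfl fun i _ => ?_
      have : cs.simple s * r * cs.simple s = altProd (cs.simple t) (cs.simple s) (2 * i + 1) ↔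
          r = altProd (cs.simple s) (cs.simple t) (2 * (i + 1) + 1) := by
        have e : altProd (cs.simple s) (cs.simple t) (2 * (i + 1) + 1) =
            cs.simple s * altProd (cs.simple t) (cs.simple s) (2 * i + 1) * cs.simple s := by
          have aux : ∀ (a b : W) (k : ℕ), altProd a b (2 * k + 1) * b =
              a * altProd b a (2 * k + 1) := by
            intro a b k
            induction k generalizing a b with
            | zero => simp [altProd]
            | succ k ih =>
              have h1 : ∀ a b : W, altProd a b (2 * (k + 1) + 1) =
                  a * (b * altProd a b (2 * k + 1)) := fun _ _ => rfl
              rw [h1 a b, h1 b a, mul_assoc, mul_assoc, ih]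
          rw [mul_assoc, aux]; rfl
        rw [e]
        constructor
        · intro h; rw [← h]; simp [mul_assoc]
        · intro h; rw [h]; simp [mul_assoc]
      simp only [this]
    · simp [altProd]

theorem altProd_two_mul_add_one {G : Type*} [Monoid G] (a b : G) (n : ℕ) :
    altProd a b (2 * n + 1) = (a * b) ^ n * a := by
  induction n with
  | zero => simp [altProd]
  | succ n ih =>
    have h1 : altProd a b (2 * (n + 1) + 1) = a * (b * altProd a b (2 * n + 1)) := rfl
    rw [h1, ih, pow_succ']
    simp [mul_assoc]

/-- Both sides list the same reflections of the dihedral group, in opposite orders: index `i`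
corresponds to `m - 1 - i`. -/
theorem altProd_affineReflection_braid (s t : B) :
    altProd (cs.affineReflection s) (cs.affineReflection t) (M s t) =
      altProd (cs.affineReflection t) (cs.affineReflection s) (M s t) := by
  classical
  ext v r
  rw [altProd_affineReflection_apply, altProd_affineReflection_apply, cs.altProd_simple_braid]
  congr 1
  rw [← Finset.sum_range_reflect]
  refine Finset.sum_congr rfl fun i hi => ?_
  have hi' := Finset.mem_range.1 hi
  have : altProd (cs.simple s) (cs.simple t) (2 * (M s t - 1 - i) + 1) =
      altProd (cs.simple t) (cs.simple s) (2 * i + 1) := by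
    rw [altProd_two_mul_add_one, altProd_two_mul_add_one, ← mul_left_inj (cs.simple t),
      simple_mul_simple_cancel_right, mul_assoc, ← pow_succ,
      ← mul_left_inj ((cs.simple s * cs.simple t) ^ i), ← pow_add,
      show M s t - 1 - i + 1 + i = M s t by omega, simple_mul_simple_pow]
    have : cs.simple t * cs.simple s = (cs.simple s * cs.simple t)⁻¹ := by simp
    rw [this, inv_pow, inv_mul_cancel]
  rw [this]

/-- The action of the Artin group on the functions on the Coxeter group by affine permutations. -/
noncomputable def artinAffine : M.ArtinGroup →* Equiv.Perm (W → ℤ) :=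
  M.artinLift cs.affineReflection cs.altProd_affineReflection_braid

/-- The inversion cocycle: on the lift of an element `w` of the Coxeter group, it is the indicator
function of the set of (left) inversions of `w`. -/
noncomputable def inversionCocycle (x : M.ArtinGroup) : W → ℤ := cs.artinAffine x 0

open Classical in
theorem inversionCocycle_artinGen (s : B) (r : W) :
    cs.inversionCocycle (M.artinGen s) r = if r = cs.simple s then 1 else 0 := by
  rw [inversionCocycle, artinAffine, artinLift_artinGen, affineReflection_apply]
  simp

/-- The linear part of the action is conjugation through `W`. The cocycle rule follows. -/
theorem artinAffine_apply (x : M.ArtinGroup) (v : W → ℤ) (r : W) :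
    cs.artinAffine x v r =
      cs.inversionCocycle x r + v ((cs.artinProj x)⁻¹ * r * cs.artinProj x) := by
  classical
  have hx : x ∈ Subgroup.closure (Set.range M.artinGen) := by
    rw [M.closure_range_artinGen]; trivial
  induction hx using Subgroup.closure_induction generalizing v r with
  | mem x hx =>
    obtain ⟨s, rfl⟩ := hx
    rw [inversionCocycle_artinGen, artinProj_artinGen, artinAffine, artinLift_artinGen,
      affineReflection_apply, inv_simple, add_comm]
  | one => simp [inversionCocycle]
  | mul x y _ _ hx hy =>
    have h : cs.inversionCocycle (x * y) r = cs.inversionCocycle x r +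
        cs.inversionCocycle y ((cs.artinProj x)⁻¹ * r * cs.artinProj x) := by
      rw [inversionCocycle, map_mul, Equiv.Perm.mul_apply, hx]; rfl
    rw [h, map_mul, Equiv.Perm.mul_apply, hx, hy, map_mul]
    simp [mul_assoc, add_assoc]
  | inv x _ hx =>
    have key : ∀ (u : W → ℤ) (q : W), cs.artinAffine x⁻¹ u q =
        u (cs.artinProj x * q * (cs.artinProj x)⁻¹) -
          cs.inversionCocycle x (cs.artinProj x * q * (cs.artinProj x)⁻¹) := by
      intro u q
      have h := hx (cs.artinAffine x⁻¹ u) (cs.artinProj x * q * (cs.artinProj x)⁻¹)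
      rw [← Equiv.Perm.mul_apply, ← map_mul, mul_inv_cancel, map_one, Equiv.Perm.one_apply] at h
      have e : (cs.artinProj x)⁻¹ * (cs.artinProj x * q * (cs.artinProj x)⁻¹) * cs.artinProj x =
          q := by group
      rw [e] at h
      linarith
    rw [inversionCocycle, key, key, map_inv, inv_inv, Pi.zero_apply]
    ring

theorem inversionCocycle_mul (x y : M.ArtinGroup) (r : W) :
    cs.inversionCocycle (x * y) r = cs.inversionCocycle x r +
      cs.inversionCocycle y ((cs.artinProj x)⁻¹ * r * cs.artinProj x) := by
  rw [inversionCocycle, map_mul, Equiv.Perm.mul_apply, artinAffine_apply]; rfl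

/-- The inversion cocycle is a homomorphism on the pure Artin group. -/
noncomputable def pureInversionHom : cs.artinProj.ker →* Multiplicative (W → ℤ) where
  toFun x := Multiplicative.ofAdd (cs.inversionCocycle x)
  map_one' := by
    rw [← ofAdd_zero]; congr 1
  map_mul' x y := by
    rw [← ofAdd_add]; congr 1
    ext r
    have hx : cs.artinProj x = 1 := x.2
    simp [inversionCocycle_mul, hx]

/-! ### The cocycle on positive words and on central elements -/

/-- The positive element of the Artin group represented by a word. -/
def artinWordProd (M : CoxeterMatrix B) (ω : List B) : M.ArtinGroup := (ω.map M.artinGen).prod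

theorem artinWordProd_cons (s : B) (ω : List B) :
    artinWordProd M (s :: ω) = M.artinGen s * artinWordProd M ω := by
  simp [artinWordProd]

theorem artinProj_artinWordProd (ω : List B) :
    cs.artinProj (artinWordProd M ω) = cs.wordProd ω := by
  induction ω with
  | nil => simp [artinWordProd]
  | cons s ω ih => rw [artinWordProd_cons, map_mul, ih, artinProj_artinGen, wordProd_cons]

theorem artinWordProd_mem_closure {T : Set B} {ω : List B} (hω : ∀ s ∈ ω, s ∈ T) :
    artinWordProd M ω ∈ Subgroup.closure (M.artinGen '' T) := by
  refine Subgroup.list_prod_mem _ fun x hx => ?_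
  obtain ⟨s, hs, rfl⟩ := List.mem_map.1 hx
  exact Subgroup.subset_closure ⟨s, hω s hs, rfl⟩

open Classical in
theorem inversionCocycle_artinWordProd_cons (s : B) (ω : List B) (r : W) :
    cs.inversionCocycle (artinWordProd M (s :: ω)) r = (if r = cs.simple s then 1 else 0) +
      cs.inversionCocycle (artinWordProd M ω) (cs.simple s * r * cs.simple s) := by
  rw [artinWordProd_cons, inversionCocycle_mul, inversionCocycle_artinGen, artinProj_artinGen,
    inv_simple]

theorem inversionCocycle_artinWordProd_nil (r : W) :
    cs.inversionCocycle (artinWordProd M []) r = 0 := by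
  simp [artinWordProd, inversionCocycle]

theorem inversionCocycle_artinWordProd_nonneg (ω : List B) (r : W) :
    0 ≤ cs.inversionCocycle (artinWordProd M ω) r := by
  classical
  induction ω generalizing r with
  | nil => rw [inversionCocycle_artinWordProd_nil]
  | cons s ω ih =>
    rw [inversionCocycle_artinWordProd_cons]
    exact add_nonneg (by split_ifs <;> simp) (ih _)

/-- The first letter contributes `1`, and the later letters of a positive word cannot cancel it. -/
theorem inversionCocycle_artinWordProd_cons_pos (s : B) (ω : List B) :
    0 < cs.inversionCocycle (artinWordProd M (s :: ω)) (cs.simple s) := by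
  classical
  rw [inversionCocycle_artinWordProd_cons, if_pos rfl]
  have := cs.inversionCocycle_artinWordProd_nonneg ω (cs.simple s * cs.simple s * cs.simple s)
  omega

theorem mem_specialSubgroup_of_inversionCocycle_ne_zero {T : Set B} {ω : List B}
    (hω : ∀ s ∈ ω, s ∈ T) {r : W} (hr : cs.inversionCocycle (artinWordProd M ω) r ≠ 0) :
    r ∈ cs.specialSubgroup T := by
  classical
  induction ω generalizing r with
  | nil => exact absurd (cs.inversionCocycle_artinWordProd_nil r) hr
  | cons s ω ih =>
    have hs : cs.simple s ∈ cs.specialSubgroup T :=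
      simple_mem_specialSubgroup (hω s (by simp))
    rw [inversionCocycle_artinWordProd_cons] at hr
    by_cases h : r = cs.simple s
    · rwa [h]
    · rw [if_neg h, zero_add] at hr
      have := ih (fun t ht => hω t (by simp [ht])) hr
      rwa [Subgroup.mul_mem_cancel_right _ hs, Subgroup.mul_mem_cancel_left _ hs] at this

variable {cs} in
-- For a generator `s`, compare the cocycle rule for `z s` and `s z`, using that `z` is pure; then
-- generate `W_T`.
theorem inversionCocycle_conj {T : Set B} {z : M.ArtinGroup} (hz : cs.artinProj z = 1)
    (hc : ∀ s ∈ T, Commute z (M.artinGen s)) {w : W} (hw : w ∈ cs.specialSubgroup T) (r : W) :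
    cs.inversionCocycle z (w * r * w⁻¹) = cs.inversionCocycle z r := by
  induction hw using Subgroup.closure_induction generalizing r with
  | mem x hx =>
    obtain ⟨s, hs, rfl⟩ := hx
    have h := congrArg (fun x => cs.inversionCocycle x r) (hc s hs).eq
    simp only [inversionCocycle_mul, hz, artinProj_artinGen, inv_simple, inv_one, one_mul,
      mul_one] at h ⊢
    linarith
  | one => simp
  | mul x y _ _ hx hy => rw [← hy r, ← hx (y * r * y⁻¹)]; congr 1; group
  | inv x _ hx => rw [← hx]; congr 1; group

/-! ### Reflections of full support -/

theorem coroot_single_nonpos (M : CoxeterMatrix B) {s t : B} (hst : s ≠ t) :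
    M.coroot s (Finsupp.single t 1) ≤ 0 := by
  have h : 0 ≤ sinRatio (Real.pi / M s t) 2 := by
    refine sinRatio_nonneg (M.off_diagonal s t hst) ?_
    have := M.off_diagonal s t hst
    omega
  rw [coroot_single]
  simp only [sinRatio] at h
  linarith

theorem coroot_single_neg (M : CoxeterMatrix B) {s t : B} (hst : M.diagram.Adj s t) :
    M.coroot s (Finsupp.single t 1) < 0 := by
  have h1 := M.off_diagonal s t hst.1
  have h2 := hst.2
  have hcos : 0 < Real.cos (Real.pi / M s t) := by
    apply Real.cos_pos_of_mem_Ioo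
    rcases Nat.eq_zero_or_pos (M s t) with h0 | h0
    · rw [h0]; simp; positivity
    have h3 : (3 : ℝ) ≤ M s t := by exact_mod_cast (show 3 ≤ M s t by omega)
    have : 0 < Real.pi / M s t := by positivity
    refine ⟨by linarith [Real.pi_pos], ?_⟩
    rw [div_lt_div_iff₀ (by linarith) (by norm_num)]
    nlinarith [Real.pi_pos]
  rw [coroot_single]
  linarith

variable {cs} in
/-- In a connected special subgroup every simple root is conjugate to a root of full support. -/
theorem exists_root_full_support [Finite B] {T : Set B} (hT : (M.diagram.induce T).Connected)
    {s : B} (hs : s ∈ T) : ∃ w ∈ cs.specialSubgroup T,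
      ∀ t ∈ T, 0 < cs.geomRep w (Finsupp.single s 1) t := by
  classical
  -- The supports of nonnegative roots in the orbit of `α_s`. If a maximal one misses part of `T`,
  -- connectedness gives an edge from `u` inside to `t` outside; reflecting in `t` adds `t` with a
  -- positive coefficient.
  let P : Set (Set B) := {U | s ∈ U ∧ U ⊆ T ∧ ∃ w ∈ cs.specialSubgroup T,
    (∀ t ∈ U, 0 < cs.geomRep w (Finsupp.single s 1) t) ∧
    ∀ t ∉ U, cs.geomRep w (Finsupp.single s 1) t = 0}
  have hP : P.Nonempty := by
    refine ⟨{s}, rfl, by simpa using hs, 1, one_mem _, ?_, ?_⟩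
    · rintro t rfl; simp
    · intro t ht
      have : s ≠ t := fun h => ht (by simp [h])
      simp [this]
  obtain ⟨U, ⟨hsU, hUT, w, hw, hpos, hzero⟩, hmax⟩ := (Set.toFinite P).exists_maximal hP
  suffices h : T ⊆ U from ⟨w, hw, fun t ht => hpos t (h ht)⟩
  by_contra hcon
  obtain ⟨t₀, ht₀, ht₀U⟩ := Set.not_subset.1 hcon
  obtain ⟨p⟩ := hT.preconnected ⟨s, hs⟩ ⟨t₀, ht₀⟩
  obtain ⟨d, -, hd1, hd2⟩ := p.exists_boundary_dart (Subtype.val ⁻¹' U) hsU ht₀U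
  set u : B := d.fst.1
  set t : B := d.snd.1
  have hadj : M.diagram.Adj u t := d.adj
  have huU : u ∈ U := hd1
  have htU : t ∉ U := hd2
  have htT : t ∈ T := d.snd.2
  set β := cs.geomRep w (Finsupp.single s 1) with hβ
  have hcor : M.coroot t β < 0 := by
    have e : M.coroot t β = ∑ x ∈ β.support, β x * M.coroot t (Finsupp.single x 1) := by
      conv_lhs => rw [← Finsupp.sum_single β]
      rw [Finsupp.sum, map_sum]
      refine Finset.sum_congr rfl fun x _ => ?_
      rw [← smul_eq_mul, ← map_smul, Finsupp.smul_single_one]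
    have hmem : ∀ x ∈ β.support, x ∈ U := fun x hx => by
      by_contra h
      exact (Finsupp.mem_support_iff.1 hx) (hzero x h)
    rw [e]
    refine Finset.sum_neg' (fun x hx => ?_) ⟨u, ?_, ?_⟩
    · exact mul_nonpos_of_nonneg_of_nonpos (hpos x (hmem x hx)).le
        (coroot_single_nonpos M fun h => htU (h ▸ hmem x hx))
    · exact Finsupp.mem_support_iff.2 (hpos u huU).ne'
    · exact mul_neg_of_pos_of_neg (hpos u huU) (coroot_single_neg M hadj.symm)
  have hval : ∀ x, cs.geomRep (cs.simple t * w) (Finsupp.single s 1) x =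
      β x - M.coroot t β * Finsupp.single t (1 : ℝ) x := by
    intro x
    rw [geomRep_mul_apply, geomRep_simple, Finsupp.sub_apply, Finsupp.smul_apply, smul_eq_mul]
  have hins : insert t U ∈ P := by
    refine ⟨Or.inr hsU, Set.insert_subset htT hUT, cs.simple t * w,
      mul_mem (simple_mem_specialSubgroup htT) hw, ?_, ?_⟩
    · rintro x (rfl | hx)
      · rw [hval, hzero _ htU]; simp [hcor]
      · have : t ≠ x := fun h => htU (h ▸ hx)
        rw [hval]; simpa [this] using hpos x hx
    · intro x hx
      have h1 : t ≠ x := fun h => hx (by simp [h])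
      have h2 : x ∉ U := fun h => hx (by simp [h])
      rw [hval]; simpa [h1] using hzero x h2
  exact htU (hmax hins (Set.subset_insert t U) (Set.mem_insert t U))

variable {cs} in
-- The reflection negates its root, while an element of `W_{T'}` preserves all coordinates outside
-- `T'`.
theorem subset_of_reflection_mem {T T' : Set B} {w : W} {s : B}
    (hpos : ∀ t ∈ T, 0 < cs.geomRep w (Finsupp.single s 1) t)
    (hmem : w * cs.simple s * w⁻¹ ∈ cs.specialSubgroup T') : T ⊆ T' := by
  intro t ht
  by_contra htT'
  have h := geomRep_apply_of_notMem hmem htT' (cs.geomRep w (Finsupp.single s 1))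
  rw [← geomRep_mul_apply, inv_mul_cancel_right, geomRep_mul_simple_self, Finsupp.neg_apply] at h
  linarith [hpos t ht]

/-! ### The standard abelian subgroups -/

/-- A central element of the irreducible spherical special subgroup of type `T` of the pure Artin
group (the square of the Garside element), with a reflection `r` of full support which detects it. -/
theorem exists_central_element [Finite B] (T : cs.IrredSpherical) :
    ∃ (z : cs.artinProj.ker) (r : W), z.1 ∈ Subgroup.closure (M.artinGen '' T.1) ∧
      (∀ s ∈ T.1, Commute z.1 (M.artinGen s)) ∧ cs.inversionCocycle z r ≠ 0 ∧
      (∀ r', cs.inversionCocycle z r' ≠ 0 → r' ∈ cs.specialSubgroup T.1) ∧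
      ∀ T' : Set B, r ∈ cs.specialSubgroup T' → T.1 ⊆ T' := by
  obtain ⟨T, hT, hconn⟩ := T
  obtain ⟨s₀⟩ := hconn.nonempty
  obtain ⟨ω, hne, hωT, hω1, hcomm⟩ := hT.exists_central_word ⟨s₀.1, s₀.2⟩ M.artinGen_braid
  obtain ⟨s, ρ, rfl⟩ := List.exists_cons_of_ne_nil hne
  obtain ⟨w, hw, hpos⟩ := exists_root_full_support (cs := cs) hconn (hωT s (by simp))
  have hz : cs.artinProj (artinWordProd M (s :: ρ)) = 1 := by
    rw [artinProj_artinWordProd, hω1]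
  refine ⟨⟨artinWordProd M (s :: ρ), hz⟩, w * cs.simple s * w⁻¹, artinWordProd_mem_closure hωT,
    hcomm, ?_, fun r' => cs.mem_specialSubgroup_of_inversionCocycle_ne_zero hωT,
    fun T' => subset_of_reflection_mem hpos⟩
  -- The cocycle is positive at the first letter `s` of the word; conjugation invariance carries
  -- this value to the reflection of full support.
  rw [inversionCocycle_conj hz hcomm hw]
  exact (cs.inversionCocycle_artinWordProd_cons_pos s ρ).ne'

end CoxeterSystem

/-! ### Edge-length metrics -/

namespace SimpleGraph

variable {X : Type*} (G : SimpleGraph X) (hG : G.Connected)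

theorem discreteTopology_edgeMetric :
    letI : MetricSpace X := G.edgeMetric hG
    DiscreteTopology X := by
  let _ : MetricSpace X := G.edgeMetric hG
  refine DiscreteTopology.of_forall_le_dist one_pos fun x y hxy => ?_
  have : 1 ≤ G.dist x y := hG.pos_dist_of_ne hxy
  change (1 : ℝ) ≤ (G.dist x y : ℝ)
  exact_mod_cast this

theorem lipschitzWith_edgeMetric {Y : Type*} [MetricSpace Y] {f : X → Y} {C : NNReal}
    (h : ∀ x y, G.Adj x y → Dist.dist (f x) (f y) ≤ C) :
    letI : MetricSpace X := G.edgeMetric hG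
    LipschitzWith C f := by
  let _ : MetricSpace X := G.edgeMetric hG
  have key : ∀ (x y : X) (p : G.Walk x y), Dist.dist (f x) (f y) ≤ C * p.length := by
    intro x y p
    induction p with
    | nil => simp
    | @cons u v w hadj p ih =>
      rw [SimpleGraph.Walk.length_cons]
      push_cast
      linarith [dist_triangle (f u) (f v) (f w), h _ _ hadj]
  refine LipschitzWith.of_dist_le_mul fun x y => ?_
  obtain ⟨p, hp⟩ := hG.exists_walk_length_eq_dist x y
  change _ ≤ _ * (G.dist x y : ℝ)
  rw [← hp]
  exact key x y p

end SimpleGraph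

/-! ### Finite balls and bounded right translations in word metrics -/

section WordMetric

open scoped Pointwise

variable {G : Type*} [Group G] (A : Finset G) (hA : Subgroup.closure (A : Set G) = ⊤)

theorem wordMetric_finite_ball (D : ℝ) :
    letI : MetricSpace G := wordMetric A hA
    ∃ S : Set G, S.Finite ∧ ∀ x y : G, dist x y ≤ D → x⁻¹ * y ∈ S := by
  let _ : MetricSpace G := wordMetric A hA
  have hG := SimpleGraph.mulCayley_connected hA
  let R : Set G := insert 1 ((A : Set G) ∪ (A : Set G)⁻¹)
  have hR : R.Finite := (A.finite_toSet.union A.finite_toSet.inv).insert 1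
  have key : ∀ (n : ℕ), ∃ S : Set G, S.Finite ∧ ∀ (x y : G)
      (p : (SimpleGraph.mulCayley (A : Set G)).Walk x y), p.length ≤ n → x⁻¹ * y ∈ S := by
    intro n
    induction n with
    | zero =>
      refine ⟨{1}, Set.finite_singleton _, fun x y p hp => ?_⟩
      rw [SimpleGraph.Walk.eq_of_length_eq_zero (Nat.le_zero.1 hp)]; simp
    | succ n ih =>
      obtain ⟨S, hS, h⟩ := ih
      refine ⟨R * S ∪ {1}, (hR.mul hS).union (Set.finite_singleton _), fun x y p hp => ?_⟩
      cases p with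
      | nil => right; simp
      | cons hadj q =>
        rename_i z
        left
        have hq := h _ _ q (by simpa using hp)
        refine Set.mem_mul.2 ⟨x⁻¹ * z, ?_, z⁻¹ * y, hq, by group⟩
        obtain ⟨-, g, hg, rfl | rfl⟩ := (SimpleGraph.mulCayley_adj' _ _ _).1 hadj
        · right; left; simpa using hg
        · right; right; simpa using hg
  obtain ⟨S, hS, h⟩ := key ⌊D⌋₊
  refine ⟨S, hS, fun x y hxy => ?_⟩
  obtain ⟨p, hp⟩ := hG.exists_walk_length_eq_dist x y
  exact h x y p (hp ▸ Nat.le_floor hxy)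

/-- The bound must be uniform in `x`: it is what turns finitely many right factors into a Lipschitz
constant. -/
theorem wordMetric_exists_dist_mul_le (g : G) :
    letI : MetricSpace G := wordMetric A hA
    ∃ C : ℝ, ∀ x : G, dist x (x * g) ≤ C := by
  let _ : MetricSpace G := wordMetric A hA
  have hg : g ∈ Subgroup.closure (A : Set G) := by rw [hA]; trivial
  induction hg using Subgroup.closure_induction with
  | mem a ha =>
    refine ⟨1, fun x => ?_⟩
    by_cases h : x = x * a
    · rw [← h]; simp
    · have : (SimpleGraph.mulCayley (A : Set G)).dist x (x * a) = 1 :=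
        SimpleGraph.dist_eq_one_iff_adj.2
          ((SimpleGraph.mulCayley_adj' _ _ _).2 ⟨h, a, ha, Or.inl rfl⟩)
      change ((SimpleGraph.mulCayley (A : Set G)).dist x (x * a) : ℝ) ≤ 1
      rw [this]; simp
  | one => exact ⟨0, fun x => by simp⟩
  | mul a b _ _ ha hb =>
    obtain ⟨C, hC⟩ := ha
    obtain ⟨C', hC'⟩ := hb
    refine ⟨C + C', fun x => ?_⟩
    rw [← mul_assoc]
    exact (dist_triangle _ (x * a) _).trans (add_le_add (hC x) (hC' _))
  | inv a _ ha =>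
    obtain ⟨C, hC⟩ := ha
    refine ⟨C, fun x => ?_⟩
    have := hC (x * a⁻¹)
    rwa [inv_mul_cancel_right, dist_comm] at this

end WordMetric

/-- Commutation is required only where exponents are nonzero, since the product runs over all `T`
while only the `z_T` of a nested set commute. -/
theorem List.prod_map_zpow_add_of_commute {ι G : Type*} [Group G] (z : ι → G) {a b : ι → ℤ}
    (h : ∀ i j, a i ≠ 0 → b j ≠ 0 → Commute (z i) (z j)) (L : List ι) :
    (L.map fun i => z i ^ (a i + b i)).prod =
      (L.map fun i => z i ^ a i).prod * (L.map fun i => z i ^ b i).prod := by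
  induction L with
  | nil => simp
  | cons i L ih =>
    have hc : Commute (z i ^ b i) (L.map fun i => z i ^ a i).prod := by
      refine Commute.list_prod_right _ _ fun x hx => ?_
      obtain ⟨j, -, rfl⟩ := List.mem_map.1 hx
      by_cases hb : b i = 0
      · rw [hb, zpow_zero]; exact Commute.one_left _
      by_cases ha : a j = 0
      · rw [ha, zpow_zero]; exact Commute.one_right _
      · exact (h j i ha hb).symm.zpow_zpow _ _
    rw [List.map_cons, List.prod_cons, ih, zpow_add, List.map_cons, List.prod_cons, List.map_cons,
      List.prod_cons]
    rw [mul_assoc, mul_assoc, ← mul_assoc (z i ^ b i), hc.eq, mul_assoc]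

/-! ### Products of central elements and their exponents -/

namespace CoxeterSystem

open CoxeterMatrix

variable {B W : Type*} [Group W] {M : CoxeterMatrix B} (cs : CoxeterSystem M W)

theorem commute_of_mem_closure {G : Type*} [Group G] {z : G} {S : Set G}
    (h : ∀ s ∈ S, Commute z s) {x : G} (hx : x ∈ Subgroup.closure S) : Commute z x := by
  have : Subgroup.closure S ≤ Subgroup.centralizer {z} := by
    rw [Subgroup.closure_le]
    intro s hs
    rw [SetLike.mem_coe, Subgroup.mem_centralizer_singleton_iff]
    exact (h s hs).eq.symm
  exact (Subgroup.mem_centralizer_singleton_iff.1 (this hx)).symm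

variable {cs} in
/-- The exponents of a vertex of the cone on the octahedralization. -/
def signedExponent (x : cs.standardAbelianComplex.octahedralization.ConeVertex)
    (T : cs.IrredSpherical) : ℤ := x.1 (T, 1) - x.1 (T, -1)

variable {cs} in
theorem coneVertex_eq_zero_of_ne {x : cs.standardAbelianComplex.octahedralization.ConeVertex}
    {T : cs.IrredSpherical} {ε ε' : ℤˣ} (h : ε ≠ ε') (hx : x.1 (T, ε) ≠ 0) : x.1 (T, ε') = 0 := by
  by_contra h'
  rw [← ne_eq, ← Finsupp.mem_support_iff] at h'
  rw [← Finsupp.mem_support_iff] at hx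
  rcases x.2 with h0 | hK
  · rw [h0] at hx; simp at hx
  · exact h (congrArg Prod.snd (hK.1 hx h' rfl))

variable {cs} in
-- If `x` is nonzero at `(T, ε)`, it vanishes at `(T, -ε)` and `y` vanishes at `(T, ε)`. The two
-- exponents of `T` then have opposite signs or one is zero, so their difference has no
-- cancellation.
theorem coneVertex_le_abs_sub {x y : cs.standardAbelianComplex.octahedralization.ConeVertex}
    {v : cs.IrredSpherical × ℤˣ} (hv : x.1 v = 0 ∨ y.1 v = 0) :
    (x.1 v : ℤ) ≤ |signedExponent y v.1 - signedExponent x v.1| := by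
  obtain ⟨T, ε⟩ := v
  by_cases hx : x.1 (T, ε) = 0
  · rw [hx]; simp
  have hy := hv.resolve_left hx
  have hx' := coneVertex_eq_zero_of_ne (ε' := -ε) (by
    rcases Int.units_eq_one_or ε with rfl | rfl <;> decide) hx
  rcases Int.units_eq_one_or ε with rfl | rfl
  · simp only [signedExponent, hx', hy, le_abs]
    right; push_cast; omega
  · rw [neg_neg] at hx'
    simp only [signedExponent, hx', hy, le_abs]
    left; push_cast; omega

variable [Finite B]

instance : Finite cs.IrredSpherical := Subtype.finite

/-- The central element of an irreducible spherical special subgroup. -/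
noncomputable def centralElement (T : cs.IrredSpherical) : cs.artinProj.ker :=
  (cs.exists_central_element T).choose

theorem centralElement_mem (T : cs.IrredSpherical) :
    (cs.centralElement T).1 ∈ Subgroup.closure (M.artinGen '' T.1) :=
  (cs.exists_central_element T).choose_spec.choose_spec.1

theorem commute_centralElement_artinGen (T : cs.IrredSpherical) {s : B} (hs : s ∈ T.1) :
    Commute (cs.centralElement T).1 (M.artinGen s) :=
  (cs.exists_central_element T).choose_spec.choose_spec.2.1 s hs

/-- This is the triangularity of the cocycles of the `z_T` with respect to inclusion. -/
theorem exists_inversionCocycle_centralElement (T : cs.IrredSpherical) :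
    ∃ r : W, cs.inversionCocycle (cs.centralElement T) r ≠ 0 ∧
      ∀ T' : cs.IrredSpherical, cs.inversionCocycle (cs.centralElement T') r ≠ 0 → T ≤ T' := by
  obtain ⟨r, -, -, h1, -, h2⟩ := (cs.exists_central_element T).choose_spec
  exact ⟨r, h1, fun T' h => h2 _
    ((cs.exists_central_element T').choose_spec.choose_spec.2.2.2.1 r h)⟩

theorem commute_centralElement_of_le {T T' : cs.IrredSpherical} (h : T ≤ T') :
    Commute (cs.centralElement T').1 (cs.centralElement T).1 := by
  refine commute_of_mem_closure ?_ (cs.centralElement_mem T)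
  rintro _ ⟨s, hs, rfl⟩
  exact cs.commute_centralElement_artinGen T' (h hs)

theorem commute_centralElement_of_orthogonal {T T' : cs.IrredSpherical}
    (h : M.Orthogonal T.1 T'.1) :
    Commute (cs.centralElement T).1 (cs.centralElement T').1 := by
  refine commute_of_mem_closure ?_ (cs.centralElement_mem T')
  rintro _ ⟨t, ht, rfl⟩
  refine (commute_of_mem_closure ?_ (cs.centralElement_mem T)).symm
  rintro _ ⟨s, hs, rfl⟩
  have hst := h s hs t ht
  refine (M.commute_artinGen ?_).symm
  by_contra hne
  exact hst.2 ⟨hst.1, hne⟩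

theorem commute_centralElement_of_isNested {α : Finset cs.IrredSpherical} (hα : cs.IsNested α)
    {T T' : cs.IrredSpherical} (hT : T ∈ α) (hT' : T' ∈ α) :
    Commute (cs.centralElement T).1 (cs.centralElement T').1 := by
  rcases (isNested_iff.1 hα).2 T hT T' hT' with h | h | h
  · exact (cs.commute_centralElement_of_le h).symm
  · exact cs.commute_centralElement_of_le h
  · exact cs.commute_centralElement_of_orthogonal h

/-- An enumeration of the irreducible spherical subsets. -/
noncomputable def irredSphericalList : List cs.IrredSpherical :=
  (Set.toFinite (Set.univ : Set cs.IrredSpherical)).toFinset.toList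

/-- The product of powers of the central elements, in a fixed order. -/
noncomputable def centralProd (a : cs.IrredSpherical → ℤ) : M.ArtinGroup :=
  (cs.irredSphericalList.map fun T => (cs.centralElement T).1 ^ a T).prod

theorem centralProd_add {α : Finset cs.IrredSpherical} (hα : cs.IsNested α)
    {a b : cs.IrredSpherical → ℤ} (ha : ∀ T, a T ≠ 0 → T ∈ α) (hb : ∀ T, b T ≠ 0 → T ∈ α) :
    cs.centralProd (a + b) = cs.centralProd a * cs.centralProd b :=
  List.prod_map_zpow_add_of_commute _ (fun T T' hT hT' =>
    cs.commute_centralElement_of_isNested hα (ha T hT) (hb T' hT')) _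

theorem artinProj_centralProd (a : cs.IrredSpherical → ℤ) :
    cs.artinProj (cs.centralProd a) = 1 := by
  refine Subgroup.list_prod_mem cs.artinProj.ker fun x hx => ?_
  obtain ⟨T, -, rfl⟩ := List.mem_map.1 hx
  exact zpow_mem (cs.centralElement T).2 _

theorem inversionCocycle_centralProd (a : cs.IrredSpherical → ℤ) (r : W) :
    cs.inversionCocycle (cs.centralProd a) r =
      ∑ᶠ T, a T * cs.inversionCocycle (cs.centralElement T) r := by
  classical
  have := Fintype.ofFinite cs.IrredSpherical
  have h1 : cs.centralProd a =
      ((cs.irredSphericalList.map fun T => cs.centralElement T ^ a T).prod : cs.artinProj.ker) := by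
    rw [centralProd, ← Subgroup.coe_subtype, map_list_prod, List.map_map]; rfl
  have h2 : cs.pureInversionHom
      (cs.irredSphericalList.map fun T => cs.centralElement T ^ a T).prod =
      ∏ T, cs.pureInversionHom (cs.centralElement T) ^ a T := by
    rw [map_list_prod, List.map_map, irredSphericalList, Finset.prod_map_toList]
    refine Finset.prod_congr (by ext; simp) fun T _ => ?_
    simp
  have h3 := congrArg (fun f : Multiplicative (W → ℤ) => f.toAdd r) h2
  rw [h1]
  refine h3.trans ?_
  rw [toAdd_prod, Finset.sum_apply, finsum_eq_sum_of_fintype]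
  rfl

/-- The exponents of a product of central elements are determined by its inversion cocycle. -/
theorem centralProd_exponent_unique {a b : cs.IrredSpherical → ℤ}
    (h : cs.inversionCocycle (cs.centralProd a) = cs.inversionCocycle (cs.centralProd b)) :
    a = b := by
  classical
  have := Fintype.ofFinite cs.IrredSpherical
  by_contra hab
  have hne : {T | a T ≠ b T}.Nonempty := Function.ne_iff.1 hab
  -- At the reflection `r` detecting `T` only sets containing `T` contribute, and on the larger ones
  -- the exponents agree by maximality.
  obtain ⟨T, hT, hmax⟩ := (Set.toFinite {T | a T ≠ b T}).exists_maximal hne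
  obtain ⟨r, hr, hle⟩ := cs.exists_inversionCocycle_centralElement T
  have hr' := congrFun h r
  rw [inversionCocycle_centralProd, inversionCocycle_centralProd, finsum_eq_sum_of_fintype,
    finsum_eq_sum_of_fintype, ← sub_eq_zero, ← Finset.sum_sub_distrib,
    Finset.sum_eq_single_of_mem T (Finset.mem_univ T), ← sub_mul, mul_eq_zero, sub_eq_zero] at hr'
  · exact hr'.elim hT hr
  · intro T' _ hne'
    rw [← sub_mul]
    by_contra hcon
    have h1 : a T' ≠ b T' := fun e => hcon (by rw [e, sub_self, zero_mul])
    have h2 := hle T' (right_ne_zero_of_mul hcon)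
    exact hne' (le_antisymm (hmax h1 h2) h2)

/-- The two products need not share a nested set, so this identity holds for cocycles only, by
additivity on pure elements. -/
theorem inversionCocycle_centralProd_inv_mul (a b : cs.IrredSpherical → ℤ) :
    cs.inversionCocycle ((cs.centralProd a)⁻¹ * cs.centralProd b) =
      cs.inversionCocycle (cs.centralProd (b - a)) := by
  have h1 : cs.inversionCocycle (cs.centralProd b) = cs.inversionCocycle (cs.centralProd a) +
      cs.inversionCocycle ((cs.centralProd a)⁻¹ * cs.centralProd b) := by
    ext r
    conv_lhs => rw [← mul_inv_cancel_left (cs.centralProd a) (cs.centralProd b)]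
    rw [inversionCocycle_mul, artinProj_centralProd]; simp
  rw [← sub_eq_iff_eq_add'.2 h1]
  ext r
  have := Fintype.ofFinite cs.IrredSpherical
  simp only [Pi.sub_apply, inversionCocycle_centralProd, finsum_eq_sum_of_fintype, sub_mul,
    Finset.sum_sub_distrib]

/-! ### The map on the cone -/

/-- The map from the vertices of the cone on the octahedralization to the Artin group. -/
noncomputable def coneMap (x : cs.standardAbelianComplex.octahedralization.ConeVertex) :
    M.ArtinGroup := cs.centralProd (signedExponent x)

variable {cs}

theorem finite_coneVertex_le (n : ℕ) :
    {x : cs.standardAbelianComplex.octahedralization.ConeVertex | ∀ v, x.1 v ≤ n}.Finite := by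
  let f : (cs.IrredSpherical × ℤˣ) →₀ ℕ := Finsupp.equivFunOnFinite.symm fun _ => n
  refine ((Set.finite_Icc 0 f).preimage Subtype.val_injective.injOn).subset fun x hx => ?_
  exact ⟨zero_le, fun v => by simpa [f] using hx v⟩

/-- This gives both expansion, with `y` in a disjoint simplex, and properness, with `y` the cone
point. -/
theorem finite_setOf_coneMap_inv_mul_mem {S : Set M.ArtinGroup} (hS : S.Finite) :
    {x : cs.standardAbelianComplex.octahedralization.ConeVertex |
      ∃ y, (∀ v, x.1 v = 0 ∨ y.1 v = 0) ∧ (cs.coneMap x)⁻¹ * cs.coneMap y ∈ S}.Finite := by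
  classical
  have key : ∀ g : M.ArtinGroup, {x : cs.standardAbelianComplex.octahedralization.ConeVertex |
      ∃ y, (∀ v, x.1 v = 0 ∨ y.1 v = 0) ∧ (cs.coneMap x)⁻¹ * cs.coneMap y = g}.Finite := by
    intro g
    -- The cocycle of `g` is that of at most one exponent vector `c`, and the entries of `c` bound
    -- all coordinates of `x`.
    by_cases hg : ∃ c, cs.inversionCocycle (cs.centralProd c) = cs.inversionCocycle g
    · obtain ⟨c, hc⟩ := hg
      have := Fintype.ofFinite cs.IrredSpherical
      refine (finite_coneVertex_le (Finset.univ.sup fun T => (c T).natAbs)).subset ?_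
      rintro x ⟨y, hxy, rfl⟩ v
      rw [coneMap, coneMap, inversionCocycle_centralProd_inv_mul] at hc
      have hc' := cs.centralProd_exponent_unique hc
      have h1 := coneVertex_le_abs_sub (hxy v)
      have h2 : (c v.1).natAbs ≤ Finset.univ.sup fun T => (c T).natAbs :=
        Finset.le_sup (f := fun T => (c T).natAbs) (Finset.mem_univ v.1)
      rw [Int.abs_eq_natAbs] at h1
      rw [hc'] at h2 ⊢
      exact (Int.ofNat_le.1 h1).trans h2
    · refine Set.finite_empty.subset ?_
      rintro x ⟨y, -, rfl⟩
      exact hg ⟨_, (cs.inversionCocycle_centralProd_inv_mul _ _).symm⟩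
  refine (hS.biUnion fun g _ => key g).subset ?_
  rintro x ⟨y, hxy, hg⟩
  exact Set.mem_biUnion hg ⟨y, hxy, rfl⟩

theorem finite_preimage_coneMap {S : Set M.ArtinGroup} (hS : S.Finite) :
    (cs.coneMap ⁻¹' S).Finite := by
  refine (finite_setOf_coneMap_inv_mul_mem (cs := cs) hS.inv).subset fun x hx => ?_
  refine ⟨⟨0, Or.inl Finsupp.support_zero⟩, fun v => Or.inr rfl, ?_⟩
  have : cs.coneMap ⟨0, Or.inl Finsupp.support_zero⟩ = 1 := by
    refine List.prod_eq_one fun g hg => ?_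
    obtain ⟨T, -, rfl⟩ := List.mem_map.1 hg
    simp [signedExponent]
  rw [this, mul_one]
  exact Set.inv_mem_inv.2 hx

theorem exists_coneMap_eq_mul {x y : cs.standardAbelianComplex.octahedralization.ConeVertex}
    (h : ∀ v, x.1 v ≤ y.1 v ∧ y.1 v ≤ x.1 v + 1) :
    ∃ c ∈ Set.pi Set.univ fun _ : cs.IrredSpherical => Set.Icc (-1 : ℤ) 1,
      cs.coneMap y = cs.coneMap x * cs.centralProd c := by
  classical
  refine ⟨signedExponent y - signedExponent x, fun T _ => ?_, ?_⟩
  · have h1 := h (T, 1)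
    have h2 := h (T, -1)
    simp only [Pi.sub_apply, signedExponent, Set.mem_Icc]
    omega
  · have hz : ∀ v, y.1 v = 0 → x.1 v = 0 := fun v hv => by
      have := (h v).1
      omega
    -- Since `x ≤ y`, the nested set underlying `y` (empty at the cone point) carries both exponent
    -- vectors.
    obtain ⟨α, hα, hyα⟩ : ∃ α : Finset cs.IrredSpherical, cs.IsNested α ∧
        ∀ v, y.1 v ≠ 0 → v.1 ∈ α := by
      rcases y.2 with h0 | hK
      · refine ⟨∅, IsNested.empty, fun v hv => ?_⟩
        rw [← Finsupp.mem_support_iff, h0] at hv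
        simp at hv
      · refine ⟨_, hK.2.2, fun v hv => ?_⟩
        exact (@Finset.mem_image _ _ (fun _ _ => Classical.propDecidable _) _ _ _).2
          ⟨v, Finsupp.mem_support_iff.2 hv, rfl⟩
    have hyT : ∀ T ∉ α, ∀ ε, y.1 (T, ε) = 0 := fun T hT ε => by
      by_contra hne
      exact hT (hyα _ hne)
    rw [coneMap, coneMap, ← cs.centralProd_add hα, add_sub_cancel]
    · intro T hT
      by_contra hcon
      exact hT (by simp [signedExponent, hz _ (hyT T hcon _)])
    · intro T hT
      by_contra hcon
      exact hT (by simp [signedExponent, hz _ (hyT T hcon _), hyT T hcon _])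

end CoxeterSystem

theorem theorem4p4 {B W : Type*} [Finite B] [Group W] {M : CoxeterMatrix B}
    (cs : CoxeterSystem M W) (A : Finset M.ArtinGroup)
    (hA : Subgroup.closure (A : Set M.ArtinGroup) = ⊤) :
    letI : MetricSpace M.ArtinGroup := wordMetric A hA
    cs.standardAbelianComplex.octahedralization.SubsetBoundary M.ArtinGroup := by
  let _ : MetricSpace M.ArtinGroup := wordMetric A hA
  have : DiscreteTopology M.ArtinGroup := SimpleGraph.discreteTopology_edgeMetric _
    (SimpleGraph.mulCayley_connected hA)
  have : DiscreteTopology cs.standardAbelianComplex.octahedralization.ConeVertex :=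
    SimpleGraph.discreteTopology_edgeMetric _
      (AbstractSimplicialComplex.coneTriangulation_connected _)
  refine ⟨cs.coneMap, ?_, ?_, ?_⟩
  · refine isProperMap_iff_isCompact_preimage.2 ⟨continuous_of_discreteTopology, fun K hK => ?_⟩
    rw [isCompact_iff_finite] at hK ⊢
    exact CoxeterSystem.finite_preimage_coneMap hK
  · intro σ _ τ _ hστ D _
    obtain ⟨S, hS, hSD⟩ := wordMetric_finite_ball A hA D
    have hfin := CoxeterSystem.finite_setOf_coneMap_inv_mul_mem (cs := cs) hS
    -- The finite set of exceptional `x` already excludes every `y`, so nothing has to be removed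
    -- from `cone τ`.
    refine ⟨_, ∅, (hfin.preimage Subtype.val_injective.injOn).isCompact, isCompact_empty,
      fun x hx y _ => ?_⟩
    by_contra! hle
    refine hx ⟨y.1, fun v => ?_, hSD _ _ hle⟩
    by_contra! hv
    exact Finset.disjoint_left.1 hστ (x.2 (Finsupp.mem_support_iff.2 hv.1))
      (y.2 (Finsupp.mem_support_iff.2 hv.2))
  · choose C hC using wordMetric_exists_dist_mul_le A hA
    -- Only finitely many right factors occur, so their displacements have a common bound `K`.
    have hfin : (Set.pi Set.univ fun _ : cs.IrredSpherical => Set.Icc (-1 : ℤ) 1).Finite :=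
      Set.Finite.pi fun _ => Set.finite_Icc _ _
    obtain ⟨K, hK⟩ := (hfin.image fun c => C (cs.centralProd c)).bddAbove
    have key : ∀ x y : cs.standardAbelianComplex.octahedralization.ConeVertex,
        (∀ v, x.1 v ≤ y.1 v ∧ y.1 v ≤ x.1 v + 1) →
        dist (cs.coneMap x) (cs.coneMap y) ≤ K.toNNReal := by
      intro x y h
      obtain ⟨c, hc, hxy⟩ := CoxeterSystem.exists_coneMap_eq_mul h
      rw [hxy]
      exact ((hC _ _).trans (hK ⟨c, hc, rfl⟩)).trans (Real.le_coe_toNNReal K)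
    refine ⟨K.toNNReal, SimpleGraph.lipschitzWith_edgeMetric _
      (AbstractSimplicialComplex.coneTriangulation_connected _) fun x y hxy => ?_⟩
    rcases ((AbstractSimplicialComplex.coneTriangulation_adj _ x y).1 hxy).2 with h | h
    · exact key x y h
    · rw [dist_comm]; exact key y x h
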